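/- Let $\mathcal E,\mathcal E_*$ be complex Hilbert spaces. For a Hilbert space $\mathcal F$ let $L^2_{\mathcal F}$ be the space of square integrable $\mathcal F$-valued functions on the unit circle (normalized Lebesgue measure) and let $H^2_{\mathcal F}\subseteq L^2_{\mathcal F}$ be the Hardy space, i.e. the subspace of functions with vanishing Fourier coefficients of negative index; $[H^2_{\mathcal F}]^\perp$ denotes its orthocomplement in $L^2_{\mathcal F}$. Let $k\ge 1$ and let $$\Theta(z)=\sum_{m=1}^k\theta_m z^m\qquad(z\in\mathbb D)$$ be a polynomial of degree $k$ (so $\theta_k\neq 0$) whose coefficients $\theta_m\in\mathcal B(\mathcal E,\mathcal E_*)$, $1\le m\le k$, are partial isometries, and which is contractive: $\|\Theta(z)a\|\le\|a\|$ for all $z\in\mathbb D$, $a\in\mathcal E$. Put $\Delta_\Theta(e^{it})=[I-\Theta(e^{it})^*\Theta(e^{it})]^{1/2}$, let $T_\Theta:H^2_{\mathcal E}\to H^2_{\mathcal E_*}$ be the analytic Toeplitz operator $T_\Theta h=\Theta h$, let $$\mathcal H=\bigl(H^2_{\mathcal E_*}\oplus\overline{\Delta_\Theta L^2_{\mathcal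 E}}\bigr)\ominus\{\Theta h\oplus\Delta_\Theta h:\ h\in H^2_{\mathcal E}\}$$ be the Sz.-Nagy--Foia\c{s} model space of $\Theta$, and let $T\in\mathcal B(\mathcal H)$ be the model operator, the compression to $\mathcal H$ of multiplication by $e^{it}$ on $L^2_{\mathcal E_*}\oplus L^2_{\mathcal E}$. Then $$\mathcal H=\{(I-T_\Theta T_\Theta^*)f\oplus\Delta_\Theta g:\ f\in H^2_{\mathcal E_*},\ g\in[H^2_{\mathcal E}]^\perp\},\qquad T^*(u\oplus v)=e^{-it}(u-u(0))\oplus e^{-it}v\quad(u\oplus v\in\mathcal H),$$ where $u(0)$ is the Fourier coefficient of $u$ of index $0$, and $T$ is a completely non-unitary power partial isometry (every $T^n$, $n\ge1$, is a partial isometry, and there is no nonzero reducing subspace on which $T$ is unitary). Moreover $$\mathcal H_s=\Bigl(I-\sum_{m=1}^k\theta_m\theta_m^*\Bigr)H^2_{\mathcal E_*}\oplus\{0\},\qquad \mathcal H_b=\{0\}\oplus\Bigl(I-\sum_{m=1}^k\theta_m^*\theta_m\Bigr)[H^2_{\mathcal E}]^\perp,\qquad \mathcal H_t=\mathcal H\ominus(\mathcal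 H_s\oplus\mathcal H_b)$$ are closed subspaces of $\mathcal H$ that reduce $T$, they are pairwise orthogonal, $\mathcal H=\mathcal H_s\oplus\mathcal H_t\oplus\mathcal H_b$, and with respect to this decomposition $$T=\begin{pmatrix}S&0&0\\0&N&0\\0&0&C\end{pmatrix},$$ where $S\in\mathcal B(\mathcal H_s)$ is a unilateral shift (of some multiplicity, possibly $0$), $N\in\mathcal B(\mathcal H_t)$ is nilpotent of index $k$ (that is, $N^k=0$ and $N^j\ne0$ for $0\le j<k$), and $C\in\mathcal B(\mathcal H_b)$ is a backward shift (the adjoint of a unilateral shift, of some multiplicity, possibly $0$). -/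

import Mathlib

open MeasureTheory Submodule ContinuousLinearMap
open scoped ENNReal InnerProductSpace

noncomputable section

/-! ### Operators on Hilbert spaces -/

section Operators

variable {X : Type*} [NormedAddCommGroup X] [InnerProductSpace ℂ X]
variable {Y : Type*} [NormedAddCommGroup Y] [InnerProductSpace ℂ Y]

/-- A partial isometry: isometric on the orthocomplement of its kernel. -/
def IsPartialIsometry (A : X →L[ℂ] Y) : Prop :=
  ∀ x ∈ (LinearMap.ker (A : X →ₗ[ℂ] Y))ᗮ, ‖A x‖ = ‖x‖

/-- All positive powers are partial isometries. -/
def IsPowerPartialIsometry (T : X →L[ℂ] X) : Prop :=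
  ∀ n : ℕ, 1 ≤ n → IsPartialIsometry (T ^ n)

/-- `M` is a reducing (closed) subspace for `T`. -/
def IsReducing [CompleteSpace X] (T : X →L[ℂ] X) (M : Submodule ℂ X) : Prop :=
  IsClosed (M : Set X) ∧ (∀ x ∈ M, T x ∈ M) ∧ (∀ x ∈ M, (adjoint T) x ∈ M)

/-- No nonzero reducing subspace on which `T` restricts to a unitary
(a surjective isometry of `M` onto `M`). -/
def IsCompletelyNonUnitary [CompleteSpace X] (T : X →L[ℂ] X) : Prop :=
  ∀ M : Submodule ℂ X, IsReducing T M →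
    (∀ x ∈ M, ‖T x‖ = ‖x‖) → (∀ y ∈ M, ∃ x ∈ M, T x = y) → M = ⊥

/-- A unilateral shift (of arbitrary multiplicity, possibly zero): an isometry `S` with a closed
wandering subspace `W`, so that the space is the orthogonal direct sum of `W, S W, S² W, …`. -/
def IsUnilateralShift (S : X →L[ℂ] X) : Prop :=
  (∀ x, ‖S x‖ = ‖x‖) ∧
  ∃ W : Submodule ℂ X, IsClosed (W : Set X) ∧
    (∀ m n : ℕ, m ≠ n →
      W.map ((S ^ m : X →L[ℂ] X) : X →ₗ[ℂ] X) ⟂ W.map ((S ^ n : X →L[ℂ] X) : X →ₗ[ℂ] X)) ∧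
    (⨆ n : ℕ, W.map ((S ^ n : X →L[ℂ] X) : X →ₗ[ℂ] X)).topologicalClosure = ⊤

/-- A backward shift: the adjoint of a unilateral shift. -/
def IsBackwardShift (C : X →L[ℂ] X) : Prop :=
  ∃ S : X →L[ℂ] X, IsUnilateralShift S ∧ ∀ x y : X, ⟪C x, y⟫_ℂ = ⟪x, S y⟫_ℂ

/-- Nilpotent of index `k`: `k` is the least exponent with `N ^ k = 0`. -/
def IsNilpotentOfIndex (N : X →L[ℂ] X) (k : ℕ) : Prop :=
  N ^ k = 0 ∧ ∀ j < k, N ^ j ≠ 0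

end Operators

/-! ### The spaces `L²` and `H²` of the circle -/

instance factTwoPiPos : Fact (0 < 2 * Real.pi) := ⟨Real.two_pi_pos⟩

/-- The circle, parametrized by `t ∈ ℝ / 2πℤ`; its point is `e^{it} = fourier 1 t`. -/
abbrev Circ : Type := AddCircle (2 * Real.pi)

/-- Normalized Lebesgue measure on the circle. -/
abbrev circMeasure : Measure Circ := AddCircle.haarAddCircle

/-- `L²_E`. -/
abbrev L2 (E : Type*) [NormedAddCommGroup E] : Type _ := Lp E 2 circMeasure

theorem L2.integrable {E : Type*} [NormedAddCommGroup E] (f : L2 E) :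
    Integrable (f : Circ → E) circMeasure :=
  (Lp.memLp f).integrable (by norm_num)

section Spaces

variable (E : Type*) [NormedAddCommGroup E] [InnerProductSpace ℂ E] [CompleteSpace E]

/-- The Hardy space `H²_E`, as the subspace of those `f ∈ L²_E` whose Fourier coefficients of
negative index vanish. -/
def H2 : Submodule ℂ (L2 E) where
  carrier := {f | ∀ n : ℤ, n < 0 → fourierCoeff (f : Circ → E) n = 0}
  zero_mem' := by
    intro n _
    have h : fourierCoeff ((0 : L2 E) : Circ → E) n = fourierCoeff (fun _ : Circ => (0 : E)) n := by
      unfold fourierCoeff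
      apply integral_congr_ae
      filter_upwards [Lp.coeFn_zero E 2 circMeasure] with t ht
      simp
    rw [h]
    simp [fourierCoeff]
  add_mem' := by
    intro f g hf hg n hn
    have h : fourierCoeff ((f + g : L2 E) : Circ → E) n
        = fourierCoeff ((f : Circ → E) + (g : Circ → E)) n := by
      unfold fourierCoeff
      apply integral_congr_ae
      filter_upwards [Lp.coeFn_add f g] with t ht
      rw [ht]
    rw [h, fourierCoeff.add f.integrable g.integrable]
    simp [hf n hn, hg n hn]
  smul_mem' := by
    intro c f hf n hn
    have h : fourierCoeff ((c • f : L2 E) : Circ → E) n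
        = fourierCoeff (c • (f : Circ → E)) n := by
      unfold fourierCoeff
      apply integral_congr_ae
      filter_upwards [Lp.coeFn_smul c f] with t ht
      rw [ht]
    rw [h, fourierCoeff.const_smul]
    simp [hf n hn]

theorem H2.isClosed : IsClosed (H2 E : Set (L2 E)) := by
  have hc : ∀ n : ℤ, Continuous fun f : L2 E => fourierCoeff (f : Circ → E) n := by
    intro n
    have hb : ∀ f g : L2 E, dist (fourierCoeff (f : Circ → E) n) (fourierCoeff (g : Circ → E) n)
        ≤ dist f g := by
      intro f g
      have hi : ∀ u : L2 E, Integrable (fun t : Circ => fourier (-n) t • (u : Circ → E) t)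
          circMeasure := fun u => u.integrable.fourier_smul _
      rw [dist_eq_norm, dist_eq_norm]
      have h1 : fourierCoeff (f : Circ → E) n - fourierCoeff (g : Circ → E) n
          = ∫ t, fourier (-n) t • ((f - g : L2 E) : Circ → E) t ∂circMeasure := by
        unfold fourierCoeff
        rw [← integral_sub (hi f) (hi g)]
        apply integral_congr_ae
        filter_upwards [Lp.coeFn_sub f g] with t ht
        rw [ht, Pi.sub_apply, smul_sub]
      rw [h1]
      refine (norm_integral_le_integral_norm _).trans ?_
      have h2 : ∀ t : Circ, ‖fourier (-n) t • ((f - g : L2 E) : Circ → E) t‖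
          = ‖((f - g : L2 E) : Circ → E) t‖ := by
        intro t
        rw [norm_smul, fourier_apply, Circle.norm_coe, one_mul]
      simp_rw [h2]
      rw [integral_norm_eq_lintegral_enorm (Lp.aestronglyMeasurable _), Lp.norm_def]
      refine ENNReal.toReal_mono (Lp.eLpNorm_ne_top _) ?_
      rw [← eLpNorm_one_eq_lintegral_enorm]
      exact eLpNorm_le_eLpNorm_of_exponent_le (by norm_num) (Lp.aestronglyMeasurable _)
    exact (LipschitzWith.of_dist_le_mul (K := 1) (by simpa using hb)).continuous
  have : (H2 E : Set (L2 E))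
      = ⋂ n : ℤ, ⋂ _ : n < 0, {f : L2 E | fourierCoeff (f : Circ → E) n = 0} := by
    ext f
    simp [H2]
  rw [this]
  exact isClosed_iInter fun n => isClosed_iInter fun _ => isClosed_eq (hc n) continuous_const

instance : CompleteSpace (H2 E) := (H2.isClosed E).completeSpace_coe

end Spaces

/-! ### Multiplication operators -/

section Multiplication

variable {E : Type*} [NormedAddCommGroup E] [InnerProductSpace ℂ E] [CompleteSpace E]
variable {F : Type*} [NormedAddCommGroup F] [InnerProductSpace ℂ F] [CompleteSpace F]

/-- The Laurent operator `L_Φ f = Φ f`, from `L²_E` to `L²_F`, for a symbol `Φ` that is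
norm continuous on the circle. -/
def laurent (Φ : C(Circ, E →L[ℂ] F)) : L2 E →L[ℂ] L2 F :=
  (ContinuousLinearMap.id ℂ (E →L[ℂ] F)).holderL circMeasure ∞ 2 2
    (ContinuousMap.toLp ∞ circMeasure ℂ Φ)

/-- The Toeplitz operator `T_Φ = P₊ L_Φ`, from `H²_E` to `H²_F`. -/
def toeplitz (Φ : C(Circ, E →L[ℂ] F)) : H2 E →L[ℂ] H2 F :=
  (H2 F).orthogonalProjectionOnto ∘L laurent Φ ∘L (H2 E).subtypeL

/-- The scalar symbol `e^{int}`. -/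
def expSymbol (E : Type*) [NormedAddCommGroup E] [InnerProductSpace ℂ E] (n : ℤ) :
    C(Circ, E →L[ℂ] E) where
  toFun t := fourier n t • ContinuousLinearMap.id ℂ E
  continuous_toFun := (fourier n).continuous.smul continuous_const

/-- A constant symbol. -/
def constSymbol (A : E →L[ℂ] F) : C(Circ, E →L[ℂ] F) := ContinuousMap.const _ A

/-- The constant function with value `a`, as an element of `L²_E`. -/
def constL2 (a : E) : L2 E := Lp.const 2 circMeasure a

theorem continuous_cfc_sqrt {Z : Type*} [TopologicalSpace Z] [CompactSpace Z]
    {a : Z → (E →L[ℂ] E)} (ha : Continuous a) (hs : ∀ z, IsSelfAdjoint (a z)) :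
    Continuous fun z => cfc Real.sqrt (a z) := by
  obtain ⟨R, hR⟩ := (isCompact_range ha).isBounded.subset_closedBall (0 : E →L[ℂ] E)
  refine Continuous.cfc' (isCompact_closedBall (0 : ℝ) (R * ‖(1 : E →L[ℂ] E)‖)) Real.sqrt ha
    (fun z => ?_) (ha' := hs) (hf := Real.continuous_sqrt.continuousOn)
  refine (spectrum.subset_closedBall_norm_mul (𝕜 := ℝ) (a z)).trans
    (Metric.closedBall_subset_closedBall ?_)
  have := hR ⟨z, rfl⟩
  rw [mem_closedBall_zero_iff] at this
  gcongr

/-- The defect function `Δ_Θ(e^{it}) = (I - Θ(e^{it})^* Θ(e^{it}))^{1/2}`; the square root is the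
one of the continuous functional calculus. -/
def defect (Θ : C(Circ, E →L[ℂ] F)) : C(Circ, E →L[ℂ] E) where
  toFun t := cfc Real.sqrt (ContinuousLinearMap.id ℂ E - (adjoint (Θ t)) ∘L (Θ t))
  continuous_toFun := by
    refine continuous_cfc_sqrt ?_ ?_
    · exact continuous_const.sub
        ((adjoint.continuous.comp Θ.continuous).clm_comp Θ.continuous)
    · intro t
      refine IsSelfAdjoint.sub (IsSelfAdjoint.one (E →L[ℂ] E)) ?_
      exact ContinuousLinearMap.IsPositive.isSelfAdjoint (isPositive_adjoint_comp_self (Θ t))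

end Multiplication

/-! ### The Sz.-Nagy–Foias model -/

section Model

/-- The space `L²_F ⊕ L²_E`. -/
abbrev BigSpace (E F : Type*) [NormedAddCommGroup E] [NormedAddCommGroup F] : Type _ :=
  WithLp 2 (L2 F × L2 E)

variable {E : Type*} [NormedAddCommGroup E] [InnerProductSpace ℂ E] [CompleteSpace E]
variable {F : Type*} [NormedAddCommGroup F] [InnerProductSpace ℂ F] [CompleteSpace F]

/-- `K₊ = H²_F ⊕ closure (Δ_Θ L²_E)`, inside `L²_F ⊕ L²_E`. -/
def dilationSpace (Θ : C(Circ, E →L[ℂ] F)) : Submodule ℂ (BigSpace E F) :=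
  ((H2 F).prod
      (LinearMap.range (laurent (defect Θ) : L2 E →ₗ[ℂ] L2 E)).topologicalClosure).comap
    ((WithLp.prodContinuousLinearEquiv 2 ℂ (L2 F) (L2 E)) : BigSpace E F →ₗ[ℂ] L2 F × L2 E)

/-- The map `h ↦ Θ h ⊕ Δ_Θ h` on `H²_E`. -/
def graphMap (Θ : C(Circ, E →L[ℂ] F)) : H2 E →L[ℂ] BigSpace E F :=
  ((WithLp.prodContinuousLinearEquiv 2 ℂ (L2 F) (L2 E)).symm :
      L2 F × L2 E →L[ℂ] BigSpace E F) ∘L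
    ((laurent Θ).prod (laurent (defect Θ))) ∘L (H2 E).subtypeL

/-- The model space `H = K₊ ⊖ {Θ h ⊕ Δ_Θ h : h ∈ H²_E}`. -/
def modelSpace (Θ : C(Circ, E →L[ℂ] F)) : Submodule ℂ (BigSpace E F) :=
  dilationSpace Θ ⊓ (LinearMap.range (graphMap Θ : H2 E →ₗ[ℂ] BigSpace E F))ᗮ

theorem modelSpace.isClosed (Θ : C(Circ, E →L[ℂ] F)) :
    IsClosed (modelSpace Θ : Set (BigSpace E F)) := by
  refine IsClosed.inter ?_ (isClosed_orthogonal _)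
  exact IsClosed.preimage
    (WithLp.prodContinuousLinearEquiv 2 ℂ (L2 F) (L2 E)).continuous
    ((H2.isClosed F).prod (isClosed_topologicalClosure _))

instance (Θ : C(Circ, E →L[ℂ] F)) : CompleteSpace (modelSpace Θ) :=
  (modelSpace.isClosed Θ).completeSpace_coe

/-- Multiplication by `e^{it}` on `L²_F ⊕ L²_E`. -/
def bigShift (E F : Type*) [NormedAddCommGroup E] [InnerProductSpace ℂ E] [CompleteSpace E]
    [NormedAddCommGroup F] [InnerProductSpace ℂ F] [CompleteSpace F] :
    BigSpace E F →L[ℂ] BigSpace E F :=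
  ((WithLp.prodContinuousLinearEquiv 2 ℂ (L2 F) (L2 E)).symm :
      L2 F × L2 E →L[ℂ] BigSpace E F) ∘L
    ((laurent (expSymbol F 1)).prodMap (laurent (expSymbol E 1))) ∘L
    ((WithLp.prodContinuousLinearEquiv 2 ℂ (L2 F) (L2 E)) :
      BigSpace E F →L[ℂ] L2 F × L2 E)

/-- The model operator: the compression to the model space of multiplication by `e^{it}`. -/
def modelOp (Θ : C(Circ, E →L[ℂ] F)) : modelSpace Θ →L[ℂ] modelSpace Θ :=
  (modelSpace Θ).orthogonalProjectionOnto ∘L bigShift E F ∘L (modelSpace Θ).subtypeL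

end Model

/-! ### Polynomials with operator coefficients -/

section Polynomials

variable {E : Type*} [NormedAddCommGroup E] [InnerProductSpace ℂ E] [CompleteSpace E]
variable {F : Type*} [NormedAddCommGroup F] [InnerProductSpace ℂ F] [CompleteSpace F]

/-- A contractive analytic function on the open unit disc. -/
def IsContractiveAnalytic (Θ : ℂ → (E →L[ℂ] F)) : Prop :=
  AnalyticOnNhd ℂ Θ (Metric.ball 0 1) ∧ ∀ z ∈ Metric.ball (0 : ℂ) 1, ∀ a : E, ‖Θ z a‖ ≤ ‖a‖

/-- `Θ(z) = ∑_{m=1}^k θ_m z^m`. -/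
def opPoly (k : ℕ) (θ : ℕ → (E →L[ℂ] F)) (z : ℂ) : E →L[ℂ] F :=
  ∑ m ∈ Finset.Icc 1 k, z ^ m • θ m

/-- The boundary function `e^{it} ↦ Θ(e^{it})` of the polynomial `Θ`. -/
def polySymbol (k : ℕ) (θ : ℕ → (E →L[ℂ] F)) : C(Circ, E →L[ℂ] F) where
  toFun t := opPoly k θ (fourier 1 t)
  continuous_toFun := by
    unfold opPoly
    fun_prop

/-- `(I - ∑ θ_m θ_m^*) H²_F`, as a subspace `{u ⊕ 0}` of `L²_F ⊕ L²_E`. -/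
def shiftPart (k : ℕ) (θ : ℕ → (E →L[ℂ] F)) : Submodule ℂ (BigSpace E F) :=
  (((H2 F).map (laurent (constSymbol (ContinuousLinearMap.id ℂ F
      - ∑ m ∈ Finset.Icc 1 k, θ m ∘L adjoint (θ m))) : L2 F →ₗ[ℂ] L2 F)).prod ⊥).comap
    ((WithLp.prodContinuousLinearEquiv 2 ℂ (L2 F) (L2 E)) : BigSpace E F →ₗ[ℂ] L2 F × L2 E)

/-- `(I - ∑ θ_m^* θ_m) (H²_E)^⊥`, as a subspace `{0 ⊕ v}` of `L²_F ⊕ L²_E`. -/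
def backwardPart (k : ℕ) (θ : ℕ → (E →L[ℂ] F)) : Submodule ℂ (BigSpace E F) :=
  ((⊥ : Submodule ℂ (L2 F)).prod ((H2 E)ᗮ.map (laurent (constSymbol (ContinuousLinearMap.id ℂ E
      - ∑ m ∈ Finset.Icc 1 k, adjoint (θ m) ∘L θ m)) : L2 E →ₗ[ℂ] L2 E))).comap
    ((WithLp.prodContinuousLinearEquiv 2 ℂ (L2 F) (L2 E)) : BigSpace E F →ₗ[ℂ] L2 F × L2 E)

end Polynomials

end

/-! ### Fourier coefficients, multiplication operators and the Hardy space. -/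

section LaurentOperators

variable {E : Type*} [NormedAddCommGroup E] [InnerProductSpace ℂ E] [CompleteSpace E]
variable {F : Type*} [NormedAddCommGroup F] [InnerProductSpace ℂ F] [CompleteSpace F]

/-! Integrating `‖Θ(e^{it})a‖² ≤ ‖a‖²` over the circle gives `∑ ‖θ_m a‖² ≤ ‖a‖²`. If `a` lies in the
initial space of `θ_n`, the single term `‖θ_n a‖² = ‖a‖²` exhausts the bound, so `θ_m a = 0` for `m
≠ n`. The same argument for the adjoint coefficients shows that the final spaces are also pairwise
orthogonal (`orthogonalPartialIsometries_of_contractive`).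

Hence `Θ^*Θ` is constant on the circle, and the defect function is the constant projection `I - ∑
θ_m^*θ_m` onto the common kernel of the `θ_m`. Membership of `u ⊕ v` in the model space becomes a
condition on each Fourier coefficient separately (`mem_modelSpace`): `u` is analytic with `θ_m^* u_n
= 0` for `n ≥ m`, while `v` has only negative indices and `θ_m v_n = 0`. The adjoint `T^*` moves
every coefficient one place to the left and drops what `u` has at index 0.

So the component of `u` in the final space of `θ_m` occupies the indices `0, …, m-1` only, giving a
truncated shift of length `m`; the component in the common kernel of the `θ_m^*` is unrestricted,
giving a full shift; and `v` gives a backward shift. Since `θ_k ≠ 0`, blocks of length `k` do occur.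
Only `T^*` has a simple formula everywhere, so facts about `T` come from duality or from vectors
whose multiples by `e^{it}` stay in the model space. -/

theorem coeFn_laurent (Φ : C(Circ, E →L[ℂ] F)) (f : L2 E) :
    (laurent Φ f : Circ → F) =ᵐ[circMeasure] fun t => Φ t (f t) := by
  have h := (ContinuousLinearMap.id ℂ (E →L[ℂ] F)).coeFn_holder (r := 2) (μ := circMeasure)
    (ContinuousMap.toLp ∞ circMeasure ℂ Φ) f
  have h2 := ContinuousMap.coeFn_toLp (p := ∞) circMeasure (𝕜 := ℂ) Φ
  filter_upwards [h, h2] with t ht ht2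
  rw [ht2] at ht
  exact ht

/-- The `n`-th Fourier coefficient as a linear map on `L²_E`. -/
noncomputable def coeffL (n : ℤ) : L2 E →ₗ[ℂ] E where
  toFun f := fourierCoeff (f : Circ → E) n
  map_add' f g := by
    rw [fourierCoeff_congr_ae (Lp.coeFn_add f g), fourierCoeff.add f.integrable g.integrable]
    rfl
  map_smul' c f := by
    rw [fourierCoeff_congr_ae (Lp.coeFn_smul c f), fourierCoeff.const_smul]
    rfl

theorem coeffL_apply (n : ℤ) (f : L2 E) : coeffL n f = fourierCoeff (f : Circ → E) n := rfl

theorem mem_H2 {f : L2 E} : f ∈ H2 E ↔ ∀ n : ℤ, n < 0 → coeffL n f = 0 := Iff.rfl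

theorem coeffL_laurent_exp (j n : ℤ) (f : L2 E) :
    coeffL n (laurent (expSymbol E j) f) = coeffL (n - j) f := by
  rw [coeffL_apply, coeffL_apply, fourierCoeff_congr_ae (coeFn_laurent _ f)]
  unfold fourierCoeff
  congr 1
  funext t
  change fourier (-n) t • (fourier j t • ContinuousLinearMap.id ℂ E) (f t) = _
  rw [smul_apply, smul_smul, ← fourier_add, ContinuousLinearMap.id_apply]
  congr 2
  ring_nf

theorem coeffL_laurent_const (A : E →L[ℂ] F) (n : ℤ) (f : L2 E) :
    coeffL n (laurent (constSymbol A) f) = A (coeffL n f) := by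
  rw [coeffL_apply, coeffL_apply, fourierCoeff_congr_ae (coeFn_laurent _ f)]
  unfold fourierCoeff
  rw [← A.integral_comp_comm (f.integrable.fourier_smul _)]
  congr 1
  funext t
  change fourier (-n) t • A (f t) = _
  rw [A.map_smul]

theorem coeffL_constL2 (a : E) (n : ℤ) : coeffL n (constL2 a) = if n = 0 then a else 0 := by
  rw [coeffL_apply, constL2, fourierCoeff_congr_ae (Lp.coeFn_const 2 circMeasure a)]
  unfold fourierCoeff
  have h := fourierCoeff_fourier (T := 2 * Real.pi) 0
  have h2 := congrFun h n
  unfold fourierCoeff at h2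
  simp only [Function.const_apply]
  rw [integral_smul_const]
  have h3 : ∫ t : Circ, fourier (-n) t ∂circMeasure = (Pi.single (0 : ℤ) (1 : ℂ) : ℤ → ℂ) n := by
    rw [← h2]
    congr 1
    funext t
    simp
  rw [h3, Pi.single_apply]
  split_ifs <;> simp

/-- Reduces to completeness of the scalar Fourier basis by applying continuous functionals. As `E`
need not be separable, the reduction uses the separable range of a strongly measurable
representative. -/
theorem coeffL_injective {f : L2 E} (h : ∀ n, coeffL n f = 0) : f = 0 := by
  have hsep : TopologicalSpace.IsSeparable (Set.range (Lp.aestronglyMeasurable f).mk) :=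
    (Lp.aestronglyMeasurable f).stronglyMeasurable_mk.isSeparable_range
  have hf : (f : Circ → E) =ᵐ[circMeasure] (Lp.aestronglyMeasurable f).mk :=
    (Lp.aestronglyMeasurable f).ae_eq_mk
  rw [Lp.eq_zero_iff_ae_eq_zero]
  refine ae_eq_zero_of_forall_dual_of_isSeparable ℂ hsep (fun c => ?_) ?_
  · have h0 : c.compLp f = 0 := by
      apply fourierBasis.repr.injective
      ext n
      rw [fourierBasis_repr, fourierCoeff_congr_ae (c.coeFn_compLp' f), map_zero]
      have := c.integral_comp_comm (μ := circMeasure) (f.integrable.fourier_smul (-n))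
      unfold fourierCoeff
      simp only [map_smul] at this
      rw [this]
      change c (coeffL n f) = _
      rw [h n]; simp
    have h1 := c.coeFn_compLp' f
    rw [h0] at h1
    filter_upwards [h1, Lp.coeFn_zero ℂ 2 circMeasure] with t ht ht2
    rw [← ht, ht2]
  · filter_upwards [hf] with t ht
    rw [ht]; exact Set.mem_range_self t

theorem ext_coeffL {f g : L2 E} (h : ∀ n, coeffL n f = coeffL n g) : f = g := by
  rw [← sub_eq_zero]
  exact coeffL_injective fun n => by rw [map_sub, h n, sub_self]

theorem inner_laurent (Φ : C(Circ, E →L[ℂ] F)) (Ψ : C(Circ, F →L[ℂ] E))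
    (h : ∀ t, Ψ t = adjoint (Φ t)) (f : L2 E) (g : L2 F) :
    ⟪laurent Φ f, g⟫_ℂ = ⟪f, laurent Ψ g⟫_ℂ := by
  rw [L2.inner_def, L2.inner_def]
  apply integral_congr_ae
  filter_upwards [coeFn_laurent Φ f, coeFn_laurent Ψ g] with t h1 h2
  rw [h1, h2, h t, adjoint_inner_right]

theorem inner_laurent_const (A : E →L[ℂ] F) (f : L2 E) (g : L2 F) :
    ⟪laurent (constSymbol A) f, g⟫_ℂ = ⟪f, laurent (constSymbol (adjoint A)) g⟫_ℂ :=
  inner_laurent _ _ (fun _ => rfl) f g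

theorem inner_laurent_exp (j : ℤ) (f g : L2 E) :
    ⟪laurent (expSymbol E j) f, g⟫_ℂ = ⟪f, laurent (expSymbol E (-j)) g⟫_ℂ := by
  refine inner_laurent _ _ (fun t => ?_) f g
  change fourier (-j) t • ContinuousLinearMap.id ℂ E
    = adjoint (fourier j t • ContinuousLinearMap.id ℂ E)
  rw [map_smulₛₗ, fourier_neg, adjoint_id]

theorem laurent_exp_exp (i j : ℤ) (f : L2 E) :
    laurent (expSymbol E i) (laurent (expSymbol E j) f) = laurent (expSymbol E (i + j)) f :=
  ext_coeffL fun n => by simp only [coeffL_laurent_exp, sub_sub]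

theorem laurent_exp_zero (f : L2 E) : laurent (expSymbol E 0) f = f :=
  ext_coeffL fun n => by simp only [coeffL_laurent_exp, sub_zero]

theorem norm_laurent_exp (j : ℤ) (f : L2 E) : ‖laurent (expSymbol E j) f‖ = ‖f‖ := by
  rw [norm_eq_sqrt_re_inner (𝕜 := ℂ), norm_eq_sqrt_re_inner (𝕜 := ℂ), inner_laurent_exp,
    laurent_exp_exp, neg_add_cancel, laurent_exp_zero]

theorem inner_constL2 (a : E) (f : L2 E) : ⟪constL2 a, f⟫_ℂ = ⟪a, coeffL 0 f⟫_ℂ := by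
  rw [L2.inner_def, coeffL_apply]
  unfold fourierCoeff
  rw [← integral_inner (f.integrable.fourier_smul _)]
  apply integral_congr_ae
  filter_upwards [Lp.coeFn_const 2 circMeasure a] with t ht
  rw [constL2, ht]
  simp

/-- The monomial `z ^ n a` pairs with `f` through the `n`-th Fourier coefficient. -/
theorem inner_laurent_exp_constL2 (n : ℤ) (a : E) (f : L2 E) :
    ⟪laurent (expSymbol E n) (constL2 a), f⟫_ℂ = ⟪a, coeffL n f⟫_ℂ := by
  rw [inner_laurent_exp, inner_constL2, coeffL_laurent_exp]
  simp

theorem coeffL_monomial (n m : ℤ) (a : E) :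
    coeffL m (laurent (expSymbol E n) (constL2 a)) = if m = n then a else 0 := by
  rw [coeffL_laurent_exp, coeffL_constL2]
  simp [sub_eq_zero]

theorem norm_constL2 (a : E) : ‖constL2 a‖ = ‖a‖ := by
  rw [norm_eq_sqrt_re_inner (𝕜 := ℂ), norm_eq_sqrt_re_inner (𝕜 := ℂ), inner_constL2,
    coeffL_constL2, if_pos rfl]

theorem monomial_mem_H2 {n : ℤ} (hn : 0 ≤ n) (a : E) :
    laurent (expSymbol E n) (constL2 a) ∈ H2 E := by
  intro m hm
  change coeffL m _ = 0
  rw [coeffL_monomial, if_neg (by omega)]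

theorem coeffL_eq_zero_of_mem_orthogonal {f : L2 E} (hf : f ∈ (H2 E)ᗮ) {n : ℤ} (hn : 0 ≤ n) :
    coeffL n f = 0 := by
  have h := hf _ (monomial_mem_H2 hn (coeffL n f))
  rw [inner_laurent_exp_constL2] at h
  exact inner_self_eq_zero.1 h

theorem coeffL_starProjection_H2 (f : L2 E) (n : ℤ) :
    coeffL n ((H2 E).starProjection f) = if 0 ≤ n then coeffL n f else 0 := by
  split_ifs with hn
  · have h := coeffL_eq_zero_of_mem_orthogonal ((H2 E).sub_starProjection_mem_orthogonal f) hn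
    rw [map_sub, sub_eq_zero] at h
    exact h.symm
  · exact mem_H2.1 ((H2 E).starProjection_apply_mem f) n (by omega)

/-- Conversely, without nonnegative coefficients the projection of `f` to `H²` has no coefficients
at all, so `f` equals its orthogonal residue. -/
theorem mem_H2_orthogonal {f : L2 E} : f ∈ (H2 E)ᗮ ↔ ∀ n : ℤ, 0 ≤ n → coeffL n f = 0 := by
  refine ⟨fun hf n hn => coeffL_eq_zero_of_mem_orthogonal hf hn, fun h => ?_⟩
  have h0 : (H2 E).starProjection f = 0 := coeffL_injective fun n => by
    rw [coeffL_starProjection_H2]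
    split_ifs with hn
    · exact h n hn
    · rfl
  have := (H2 E).sub_starProjection_mem_orthogonal f
  rwa [h0, sub_zero] at this

end LaurentOperators

/-! ### Contractivity forces orthogonal initial and final spaces. -/

section OrthogonalCoefficients

variable {E : Type*} [NormedAddCommGroup E] [InnerProductSpace ℂ E] [CompleteSpace E]
variable {F : Type*} [NormedAddCommGroup F] [InnerProductSpace ℂ F] [CompleteSpace F]

/-- `A^*A` is the orthogonal projection onto the initial space `(ker A)ᗮ`, by polarization of the
isometry there. -/
theorem IsPartialIsometry.apply_adjoint_apply {A : E →L[ℂ] F} (hA : IsPartialIsometry A) (x : E) :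
    A (adjoint A (A x)) = A x := by
  have hc : IsClosed ((LinearMap.ker (A : E →ₗ[ℂ] F) : Submodule ℂ E) : Set E) := A.isClosed_ker
  set K : Submodule ℂ E := LinearMap.ker (A : E →ₗ[ℂ] F) with hK
  have : CompleteSpace K := hc.completeSpace_coe
  let L : Kᗮ →ₗᵢ[ℂ] F := ⟨(A : E →ₗ[ℂ] F) ∘ₗ Kᗮ.subtype, fun x => hA x x.2⟩
  have hi : ∀ x ∈ Kᗮ, ∀ y ∈ Kᗮ, ⟪A x, A y⟫_ℂ = ⟪x, y⟫_ℂ := fun x hx y hy =>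
    L.inner_map_map ⟨x, hx⟩ ⟨y, hy⟩
  have hA0 : ∀ y ∈ K, A y = 0 := fun y hy => hy
  have hdec : ∀ y, A (Kᗮ.starProjection y) = A y := by
    intro y
    have : A (y - Kᗮ.starProjection y) = 0 := by
      apply hA0
      exact (Submodule.orthogonal_orthogonal K).le (Kᗮ.sub_starProjection_mem_orthogonal y)
    rw [map_sub, sub_eq_zero] at this
    exact this.symm
  have key : adjoint A (A x) = Kᗮ.starProjection x := by
    refine ext_inner_right ℂ fun y => ?_
    rw [adjoint_inner_left, ← hdec x, ← hdec y,
      hi _ (Kᗮ.starProjection_apply_mem x) _ (Kᗮ.starProjection_apply_mem y)]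
    rw [← Submodule.inner_starProjection_left_eq_right]
    rw [Submodule.starProjection_eq_self_iff.2 (Kᗮ.starProjection_apply_mem x)]
  rw [key, hdec]

/-- A family of partial isometries with pairwise orthogonal initial spaces and pairwise
orthogonal final spaces. -/
structure OrthogonalPartialIsometries (k : ℕ) (θ : ℕ → (E →L[ℂ] F)) : Prop where
  apply_adjoint_apply : ∀ m ∈ Finset.Icc 1 k, ∀ x, θ m (adjoint (θ m) (θ m x)) = θ m x
  apply_adjoint_of_ne : ∀ m ∈ Finset.Icc 1 k, ∀ n ∈ Finset.Icc 1 k, m ≠ n →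
    ∀ y, θ m (adjoint (θ n) y) = 0
  adjoint_apply_of_ne : ∀ m ∈ Finset.Icc 1 k, ∀ n ∈ Finset.Icc 1 k, m ≠ n →
    ∀ x, adjoint (θ m) (θ n x) = 0

theorem adjoint_apply_adjoint {A : E →L[ℂ] F} (hA : ∀ x, A (adjoint A (A x)) = A x) (y : F) :
    adjoint A (A (adjoint A y)) = adjoint A y := by
  refine ext_inner_right ℂ fun x => ?_
  rw [adjoint_inner_left, ← adjoint_inner_right, adjoint_inner_left, hA, adjoint_inner_left]

theorem OrthogonalPartialIsometries.adjoint {k : ℕ} {θ : ℕ → (E →L[ℂ] F)}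
    (h : OrthogonalPartialIsometries k θ) :
    OrthogonalPartialIsometries k (fun m => adjoint (θ m)) where
  apply_adjoint_apply m hm y := by
    simpa using adjoint_apply_adjoint (h.apply_adjoint_apply m hm) y
  apply_adjoint_of_ne m hm n hn hmn y := by
    simpa using h.adjoint_apply_of_ne m hm n hn hmn y
  adjoint_apply_of_ne m hm n hn hmn y := by
    simpa using h.apply_adjoint_of_ne m hm n hn hmn y

/-- The symbol `e^{int} A`. -/
noncomputable def monomialSymbol (n : ℤ) (A : E →L[ℂ] F) : C(Circ, E →L[ℂ] F) where
  toFun t := fourier n t • A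
  continuous_toFun := (fourier n).continuous.smul continuous_const

theorem coeffL_laurent_monomialSymbol (j n : ℤ) (A : E →L[ℂ] F) (f : L2 E) :
    coeffL n (laurent (monomialSymbol j A) f) = A (coeffL (n - j) f) := by
  have h : laurent (monomialSymbol j A) f
      = laurent (expSymbol F j) (laurent (constSymbol A) f) := by
    apply Lp.ext
    filter_upwards [coeFn_laurent (monomialSymbol j A) f,
      coeFn_laurent (expSymbol F j) (laurent (constSymbol A) f),
      coeFn_laurent (constSymbol A) f] with t h1 h2 h3
    rw [h1, h2, h3]
    rfl
  rw [h, coeffL_laurent_exp, coeffL_laurent_const]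

theorem polySymbol_eq_sum (k : ℕ) (θ : ℕ → (E →L[ℂ] F)) :
    polySymbol k θ = ∑ m ∈ Finset.Icc 1 k, monomialSymbol (m : ℤ) (θ m) := by
  ext1 t
  rw [ContinuousMap.sum_apply]
  change ∑ m ∈ Finset.Icc 1 k, (fourier 1 t) ^ m • θ m
    = ∑ m ∈ Finset.Icc 1 k, fourier (m : ℤ) t • θ m
  refine Finset.sum_congr rfl fun m _ => ?_
  congr 1
  simp [fourier_apply, AddCircle.toCircle_nsmul]

theorem coeffL_laurent_polySymbol (k : ℕ) (θ : ℕ → (E →L[ℂ] F)) (n : ℤ) (f : L2 E) :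
    coeffL n (laurent (polySymbol k θ) f)
      = ∑ m ∈ Finset.Icc 1 k, θ m (coeffL (n - m) f) := by
  have h : laurent (polySymbol k θ) f
      = ∑ m ∈ Finset.Icc 1 k, laurent (monomialSymbol (m : ℤ) (θ m)) f := by
    rw [polySymbol_eq_sum]
    unfold laurent
    rw [map_sum, map_sum, sum_apply]
  rw [h, map_sum]
  exact Finset.sum_congr rfl fun m _ => coeffL_laurent_monomialSymbol _ _ _ _

/-- Pairing with the monomial `z^n a` reads off the coefficient, and `Θ` sends that monomial to `∑
z^{n+m} θ_m a`. -/
theorem coeffL_adjoint_laurent_polySymbol (k : ℕ) (θ : ℕ → (E →L[ℂ] F)) (n : ℤ) (u : L2 F) :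
    coeffL n (adjoint (laurent (polySymbol k θ)) u)
      = ∑ m ∈ Finset.Icc 1 k, adjoint (θ m) (coeffL (n + m) u) := by
  refine ext_inner_left ℂ fun a => ?_
  have h : laurent (polySymbol k θ) (laurent (expSymbol E n) (constL2 a))
      = ∑ m ∈ Finset.Icc 1 k, laurent (expSymbol F (n + m)) (constL2 (θ m a)) :=
    ext_coeffL fun i => by
      rw [coeffL_laurent_polySymbol, map_sum]
      refine Finset.sum_congr rfl fun m _ => ?_
      rw [coeffL_monomial, coeffL_monomial]
      by_cases hi : i - m = n
      · rw [if_pos hi, if_pos (by omega)]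
      · rw [if_neg hi, if_neg (by omega), map_zero]
  rw [← inner_laurent_exp_constL2, adjoint_inner_right, h, sum_inner, inner_sum]
  refine Finset.sum_congr rfl fun m _ => ?_
  rw [inner_laurent_exp_constL2, adjoint_inner_right]

theorem norm_laurent_le (Φ : C(Circ, E →L[ℂ] F)) (h : ∀ t a, ‖Φ t a‖ ≤ ‖a‖) (f : L2 E) :
    ‖laurent Φ f‖ ≤ ‖f‖ := by
  apply Lp.norm_le_norm_of_ae_le
  filter_upwards [coeFn_laurent Φ f] with t ht
  rw [ht]
  exact h t _

/-- Parseval for `y = Θa` with `a` constant: moving one `Θ` across `⟪y, y⟫` leaves only the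
coefficient of `Θ^*y` at index 0. -/
theorem sum_norm_sq_le (k : ℕ) (θ : ℕ → (E →L[ℂ] F))
    (h : ∀ t a, ‖polySymbol k θ t a‖ ≤ ‖a‖) (a : E) :
    ∑ m ∈ Finset.Icc 1 k, ‖θ m a‖ ^ 2 ≤ ‖a‖ ^ 2 := by
  set y := laurent (polySymbol k θ) (constL2 a) with hy
  have hle : ‖y‖ ≤ ‖a‖ := (norm_laurent_le _ h _).trans_eq (norm_constL2 a)
  have hc : ∀ m ∈ Finset.Icc 1 k, coeffL (m : ℤ) y = θ m a := by
    intro m hm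
    rw [hy, coeffL_laurent_polySymbol, Finset.sum_eq_single m]
    · rw [coeffL_constL2, if_pos (by omega)]
    · intro j _ hj
      rw [coeffL_constL2, if_neg (by omega), map_zero]
    · exact fun h => absurd hm h
  have hyy : ⟪y, y⟫_ℂ = ∑ m ∈ Finset.Icc 1 k, ⟪θ m a, θ m a⟫_ℂ := by
    nth_rewrite 1 [hy]
    rw [← adjoint_inner_right, inner_constL2, coeffL_adjoint_laurent_polySymbol, inner_sum]
    refine Finset.sum_congr rfl fun m hm => ?_
    rw [adjoint_inner_right, zero_add, hc m hm]
  have hsum : ‖y‖ ^ 2 = ∑ m ∈ Finset.Icc 1 k, ‖θ m a‖ ^ 2 := by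
    simp only [inner_self_eq_norm_sq_to_K] at hyy
    exact_mod_cast hyy
  rw [← hsum]
  gcongr

/-- `θ_n` is isometric at `θ_n^* y`, so its term alone uses up the whole bound. -/
theorem apply_adjoint_eq_zero_of_sum_norm_sq_le (k : ℕ) (θ : ℕ → (E →L[ℂ] F))
    (hpi : ∀ m ∈ Finset.Icc 1 k, ∀ x, θ m (adjoint (θ m) (θ m x)) = θ m x)
    (h : ∀ a, ∑ m ∈ Finset.Icc 1 k, ‖θ m a‖ ^ 2 ≤ ‖a‖ ^ 2)
    {m n : ℕ} (hm : m ∈ Finset.Icc 1 k) (hn : n ∈ Finset.Icc 1 k) (hmn : m ≠ n) (y : F) :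
    θ m (adjoint (θ n) y) = 0 := by
  have h1 : ‖θ n (adjoint (θ n) y)‖ = ‖adjoint (θ n) y‖ := by
    rw [norm_eq_sqrt_re_inner (𝕜 := ℂ), norm_eq_sqrt_re_inner (𝕜 := ℂ),
      ← adjoint_inner_left, adjoint_apply_adjoint (hpi n hn)]
  have h2 := h (adjoint (θ n) y)
  have h3 : ∑ i ∈ {m, n}, ‖θ i (adjoint (θ n) y)‖ ^ 2
      ≤ ∑ i ∈ Finset.Icc 1 k, ‖θ i (adjoint (θ n) y)‖ ^ 2 :=
    Finset.sum_le_sum_of_subset_of_nonneg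
      (by intro i hi; simp only [Finset.mem_insert, Finset.mem_singleton] at hi
          rcases hi with rfl | rfl <;> assumption)
      (fun _ _ _ => by positivity)
  rw [Finset.sum_pair hmn, h1] at h3
  have h4 : ‖θ m (adjoint (θ n) y)‖ ^ 2 ≤ 0 := by linarith
  exact norm_eq_zero.1 (pow_eq_zero_iff two_ne_zero |>.1 (le_antisymm h4 (by positivity)))

theorem norm_opPoly_le_of_norm_eq_one {k : ℕ} {θ : ℕ → (E →L[ℂ] F)}
    (h : IsContractiveAnalytic (opPoly k θ)) {z : ℂ} (hz : ‖z‖ = 1) (a : E) :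
    ‖opPoly k θ z a‖ ≤ ‖a‖ := by
  have hc : IsClosed {z : ℂ | ‖opPoly k θ z a‖ ≤ ‖a‖} := by
    refine isClosed_le ?_ continuous_const
    unfold opPoly
    fun_prop
  have hs : Metric.ball (0 : ℂ) 1 ⊆ {z : ℂ | ‖opPoly k θ z a‖ ≤ ‖a‖} := fun z hz => h.2 z hz a
  have := closure_minimal hs hc
  rw [closure_ball _ one_ne_zero] at this
  exact this (by simp [hz])

theorem orthogonalPartialIsometries_of_contractive {k : ℕ} {θ : ℕ → (E →L[ℂ] F)}
    (hpi : ∀ m ∈ Finset.Icc 1 k, IsPartialIsometry (θ m))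
    (h : IsContractiveAnalytic (opPoly k θ)) : OrthogonalPartialIsometries k θ := by
  have hpi' : ∀ m ∈ Finset.Icc 1 k, ∀ x, θ m (adjoint (θ m) (θ m x)) = θ m x :=
    fun m hm => (hpi m hm).apply_adjoint_apply
  have hf : ∀ n (t : Circ), ‖fourier n t‖ = 1 := fun n t => by
    rw [fourier_apply, Circle.norm_coe]
  refine ⟨hpi', fun m hm n hn hmn y => ?_, fun m hm n hn hmn x => ?_⟩
  · refine apply_adjoint_eq_zero_of_sum_norm_sq_le k θ hpi' (sum_norm_sq_le k θ fun t a => ?_)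
      hm hn hmn y
    exact norm_opPoly_le_of_norm_eq_one h (hf 1 t) a
  · have := apply_adjoint_eq_zero_of_sum_norm_sq_le k (fun m => adjoint (θ m))
      (fun m hm y => by simpa using adjoint_apply_adjoint (hpi' m hm) y)
      (sum_norm_sq_le k _ fun t b => ?_) hm hn hmn x
    · simpa using this
    -- The adjoint coefficients form the polynomial with boundary value `Θ(e^{-it})^*`, again a
    -- contraction.
    · have hadj : polySymbol k (fun m => adjoint (θ m)) t
          = adjoint (opPoly k θ (fourier (-1) t)) := by
        change ∑ m ∈ Finset.Icc 1 k, (fourier 1 t) ^ m • adjoint (θ m) = _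
        rw [opPoly, map_sum]
        refine Finset.sum_congr rfl fun m _ => ?_
        rw [map_smulₛₗ, fourier_neg, map_pow, Complex.conj_conj]
      rw [hadj]
      have hn : ‖adjoint (opPoly k θ (fourier (-1) t))‖ ≤ 1 := by
        rw [LinearIsometryEquiv.norm_map]
        refine ContinuousLinearMap.opNorm_le_bound _ zero_le_one fun a => ?_
        rw [one_mul]
        exact norm_opPoly_le_of_norm_eq_one h (hf _ t) a
      simpa using ContinuousLinearMap.le_of_opNorm_le _ hn b

end OrthogonalCoefficients

/-! ### The constant defect projection and the model space in Fourier coefficients. -/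

section DefectProjection

variable {E : Type*} [NormedAddCommGroup E] [InnerProductSpace ℂ E] [CompleteSpace E]
variable {F : Type*} [NormedAddCommGroup F] [InnerProductSpace ℂ F] [CompleteSpace F]

/-- The operator `I - ∑ θ_m^* θ_m`. -/
noncomputable def defectProj (k : ℕ) (θ : ℕ → (E →L[ℂ] F)) : E →L[ℂ] E :=
  ContinuousLinearMap.id ℂ E - ∑ m ∈ Finset.Icc 1 k, adjoint (θ m) ∘L θ m

theorem defectProj_apply (k : ℕ) (θ : ℕ → (E →L[ℂ] F)) (x : E) :
    defectProj k θ x = x - ∑ m ∈ Finset.Icc 1 k, adjoint (θ m) (θ m x) := by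
  simp [defectProj, sum_apply]

theorem defectProj_adjoint (k : ℕ) (θ : ℕ → (E →L[ℂ] F)) :
    defectProj k (fun m => adjoint (θ m))
      = ContinuousLinearMap.id ℂ F - ∑ m ∈ Finset.Icc 1 k, θ m ∘L adjoint (θ m) := by
  simp [defectProj]

theorem adjoint_defectProj (k : ℕ) (θ : ℕ → (E →L[ℂ] F)) :
    adjoint (defectProj k θ) = defectProj k θ := by
  rw [defectProj, map_sub, adjoint_id, map_sum]
  simp [adjoint_comp]

theorem defectProj_eq_self_of_forall {k : ℕ} {θ : ℕ → (E →L[ℂ] F)} {x : E}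
    (hx : ∀ m ∈ Finset.Icc 1 k, θ m x = 0) : defectProj k θ x = x := by
  rw [defectProj_apply, Finset.sum_eq_zero, sub_zero]
  intro m hm
  rw [hx m hm, map_zero]

namespace OrthogonalPartialIsometries

variable {k : ℕ} {θ : ℕ → (E →L[ℂ] F)} (h : OrthogonalPartialIsometries k θ)
include h

/-- By orthogonality only the `m`-th term of the sum survives `θ_m`, and it cancels `θ_m x`. So
`defectProj` projects onto the common kernel. -/
theorem apply_defectProj {m : ℕ} (hm : m ∈ Finset.Icc 1 k) (x : E) :
    θ m (defectProj k θ x) = 0 := by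
  rw [defectProj_apply, map_sub, map_sum, Finset.sum_eq_single m,
    h.apply_adjoint_apply m hm, sub_self]
  · intro n hn hnm
    exact h.apply_adjoint_of_ne m hm n hn hnm.symm _
  · exact fun h => absurd hm h

theorem defectProj_eq_self_iff {x : E} :
    defectProj k θ x = x ↔ ∀ m ∈ Finset.Icc 1 k, θ m x = 0 :=
  ⟨fun hx m hm => by rw [← hx, h.apply_defectProj hm], defectProj_eq_self_of_forall⟩

theorem defectProj_defectProj (x : E) : defectProj k θ (defectProj k θ x) = defectProj k θ x :=
  h.defectProj_eq_self_iff.2 fun _ hm => h.apply_defectProj hm x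

theorem defectProj_adjoint_apply {m : ℕ} (hm : m ∈ Finset.Icc 1 k) (y : F) :
    defectProj k θ (ContinuousLinearMap.adjoint (θ m) y) = 0 := by
  refine ext_inner_right ℂ fun x => ?_
  rw [← adjoint_defectProj, adjoint_inner_left, adjoint_inner_left, h.apply_defectProj hm,
    inner_zero_left, inner_zero_right]

/-- Orthogonal final spaces kill the cross terms, and on the diagonal the unimodular factors cancel;
nothing depends on `t`. -/
theorem adjoint_comp_polySymbol (t : Circ) :
    ContinuousLinearMap.id ℂ E
      - (ContinuousLinearMap.adjoint (polySymbol k θ t)) ∘L (polySymbol k θ t)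
      = defectProj k θ := by
  have hz : ∀ m : ℕ, (starRingEnd ℂ) (fourier 1 t ^ m) * fourier 1 t ^ m = 1 := by
    intro m
    rw [← Complex.normSq_eq_conj_mul_self, Complex.normSq_eq_norm_sq, norm_pow, fourier_apply,
      Circle.norm_coe]
    simp
  have hΘ : polySymbol k θ t = ∑ m ∈ Finset.Icc 1 k, (fourier 1 t) ^ m • θ m := rfl
  rw [defectProj]
  congr 1
  ext x
  rw [hΘ, map_sum, ContinuousLinearMap.comp_apply, sum_apply, sum_apply, sum_apply]
  refine Finset.sum_congr rfl fun m hm => ?_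
  rw [map_smulₛₗ, smul_apply, map_sum, Finset.sum_eq_single m]
  · rw [smul_apply, map_smul, smul_smul, hz, one_smul, ContinuousLinearMap.comp_apply]
  · intro n hn hnm
    rw [smul_apply, map_smul, h.adjoint_apply_of_ne m hm n hn hnm.symm, smul_zero]
  · exact fun h => absurd hm h

/-- A projection has spectrum in `{0, 1}`, where the square root is the identity. -/
theorem cfc_sqrt_defectProj : cfc Real.sqrt (defectProj k θ) = defectProj k θ := by
  have hi : IsIdempotentElem (defectProj k θ) := by
    ext x
    exact h.defectProj_defectProj x
  have hs : IsSelfAdjoint (defectProj k θ) := by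
    rw [ContinuousLinearMap.isSelfAdjoint_iff']
    exact adjoint_defectProj k θ
  have hspec : Set.EqOn Real.sqrt id (spectrum ℝ (defectProj k θ)) := by
    intro x hx
    rcases hi.spectrum_subset ℝ hx with rfl | hx
    · simp
    · rw [Set.mem_singleton_iff] at hx
      subst hx
      simp
  rw [cfc_congr hspec, cfc_id ℝ _ hs]

theorem defect_polySymbol : defect (polySymbol k θ) = constSymbol (defectProj k θ) := by
  ext1 t
  change cfc Real.sqrt (ContinuousLinearMap.id ℂ E
    - (ContinuousLinearMap.adjoint (polySymbol k θ t)) ∘L (polySymbol k θ t)) = defectProj k θ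
  rw [h.adjoint_comp_polySymbol, h.cfc_sqrt_defectProj]

/-- The closure adds nothing, because the range of a projection is its closed set of fixed vectors.
-/
theorem mem_dilationSpace {x : BigSpace E F} :
    x ∈ dilationSpace (polySymbol k θ) ↔
      (∀ n : ℤ, n < 0 → coeffL n x.fst = 0) ∧
        ∀ n, defectProj k θ (coeffL n x.snd) = coeffL n x.snd := by
  have hmem : x ∈ dilationSpace (polySymbol k θ) ↔ x.fst ∈ H2 F ∧
      x.snd ∈ (LinearMap.range (laurent (defect (polySymbol k θ)) :
        L2 E →ₗ[ℂ] L2 E)).topologicalClosure := Iff.rfl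
  rw [hmem, mem_H2, h.defect_polySymbol]
  refine and_congr_right fun _ => ?_
  set D := laurent (constSymbol (defectProj k θ)) with hD
  have hcl : IsClosed {v : L2 E | D v = v} := isClosed_eq D.continuous continuous_id
  constructor
  · intro hv n
    have hv' : x.snd ∈ {v : L2 E | D v = v} := by
      refine closure_minimal ?_ hcl hv
      rintro _ ⟨w, rfl⟩
      refine ext_coeffL fun n => ?_
      simp only [ContinuousLinearMap.coe_coe, hD, coeffL_laurent_const, h.defectProj_defectProj]
    rw [← coeffL_laurent_const, ← hD, (show D x.snd = x.snd from hv')]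
  · intro hv
    refine Submodule.le_topologicalClosure _ ⟨x.snd, ?_⟩
    refine ext_coeffL fun n => ?_
    simp only [ContinuousLinearMap.coe_coe, hD, coeffL_laurent_const, hv]

/-- The model space of an orthogonal polynomial, described by Fourier coefficients. -/
theorem mem_modelSpace {x : BigSpace E F} :
    x ∈ modelSpace (polySymbol k θ) ↔
      (∀ n : ℤ, n < 0 → coeffL n x.fst = 0) ∧
      (∀ m ∈ Finset.Icc 1 k, ∀ n : ℤ, (m : ℤ) ≤ n →
        ContinuousLinearMap.adjoint (θ m) (coeffL n x.fst) = 0) ∧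
      (∀ n : ℤ, 0 ≤ n → coeffL n x.snd = 0) ∧
      (∀ m ∈ Finset.Icc 1 k, ∀ n : ℤ, θ m (coeffL n x.snd) = 0) := by
  -- With `D` the defect projection, orthogonality to all `Θh ⊕ Dh` means `Θ^*u + Dv ⟂ H²`, which is
  -- read off at the indices `n ≥ 0`.
  have hgraph : x ∈ (LinearMap.range (graphMap (polySymbol k θ) : H2 E →ₗ[ℂ] BigSpace E F))ᗮ ↔
      ∀ n : ℤ, 0 ≤ n → ∑ m ∈ Finset.Icc 1 k,
        ContinuousLinearMap.adjoint (θ m) (coeffL (n + m) x.fst)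
          + defectProj k θ (coeffL n x.snd) = 0 := by
    have h1 : ∀ f : H2 E, ⟪graphMap (polySymbol k θ) f, x⟫_ℂ
        = ⟪(f : L2 E), ContinuousLinearMap.adjoint (laurent (polySymbol k θ)) x.fst
          + laurent (constSymbol (defectProj k θ)) x.snd⟫_ℂ := by
      intro f
      rw [inner_add_right, adjoint_inner_right]
      rw [← adjoint_defectProj, ← inner_laurent_const, ← h.defect_polySymbol]
      rfl
    have h2 : x ∈ (LinearMap.range (graphMap (polySymbol k θ) : H2 E →ₗ[ℂ] BigSpace E F))ᗮ ↔
        ContinuousLinearMap.adjoint (laurent (polySymbol k θ)) x.fst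
          + laurent (constSymbol (defectProj k θ)) x.snd ∈ (H2 E)ᗮ := by
      constructor
      · intro hx f hf
        rw [← h1 ⟨f, hf⟩]
        exact hx _ ⟨⟨f, hf⟩, rfl⟩
      · rintro hx _ ⟨f, rfl⟩
        exact (h1 f).trans (hx f f.2)
    rw [h2, mem_H2_orthogonal]
    simp only [map_add, coeffL_adjoint_laurent_polySymbol, coeffL_laurent_const]
  have hmem : x ∈ modelSpace (polySymbol k θ) ↔ x ∈ dilationSpace (polySymbol k θ) ∧
    x ∈ (LinearMap.range (graphMap (polySymbol k θ) : H2 E →ₗ[ℂ] BigSpace E F))ᗮ := Iff.rfl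
  rw [hmem, h.mem_dilationSpace, hgraph, and_assoc]
  refine and_congr_right fun _ => ?_
  simp only [h.defectProj_eq_self_iff]
  constructor
  · rintro ⟨hv, hs⟩
    have hv' : ∀ n, defectProj k θ (coeffL n x.snd) = coeffL n x.snd := fun n =>
      defectProj_eq_self_of_forall (hv n)
    have hu : ∀ m ∈ Finset.Icc 1 k, ∀ n : ℤ, 0 ≤ n →
        ContinuousLinearMap.adjoint (θ m) (coeffL (n + m) x.fst) = 0 := by
      intro m hm n hn
      -- Applying `θ_m` isolates the `m`-th term, since `θ_m D = 0` and `θ_m θ_j^* = 0` for `j ≠ m`.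
      -- Then `θ_m^*θ_mθ_m^* = θ_m^*` removes the extra `θ_m`.
      have h3 := congrArg (θ m) (hs n hn)
      rw [map_add, h.apply_defectProj hm, map_sum, Finset.sum_eq_single m, add_zero,
        map_zero] at h3
      · rw [← adjoint_apply_adjoint (h.apply_adjoint_apply m hm), h3, map_zero]
      · intro j hj hjm
        exact h.apply_adjoint_of_ne m hm j hj hjm.symm _
      · exact fun h => absurd hm h
    refine ⟨fun m hm n hn => ?_, fun n hn => ?_, fun m hm n => hv n m hm⟩
    · simpa using hu m hm (n - m) (by omega)
    · have h3 := hs n hn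
      rw [Finset.sum_eq_zero fun m hm => hu m hm n hn, zero_add, hv'] at h3
      exact h3
  · rintro ⟨hu, hv0, hv⟩
    refine ⟨fun n m hm => hv m hm n, fun n hn => ?_⟩
    rw [Finset.sum_eq_zero fun m hm => hu m hm (n + m) (by omega), hv0 n hn, map_zero, add_zero]

end OrthogonalPartialIsometries

end DefectProjection

/-! ### The model operator: its adjoint, its powers and complete non-unitarity. -/

section ModelOperator

variable {E : Type*} [NormedAddCommGroup E] [InnerProductSpace ℂ E] [CompleteSpace E]
variable {F : Type*} [NormedAddCommGroup F] [InnerProductSpace ℂ F] [CompleteSpace F]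

theorem clm_pow_succ_apply {X : Type*} [NormedAddCommGroup X] [NormedSpace ℂ X]
    (A : X →L[ℂ] X) (j : ℕ) (x : X) : (A ^ (j + 1)) x = A ((A ^ j) x) := by
  rw [pow_succ']
  rfl

theorem clm_pow_succ_apply' {X : Type*} [NormedAddCommGroup X] [NormedSpace ℂ X]
    (A : X →L[ℂ] X) (j : ℕ) (x : X) : (A ^ (j + 1)) x = (A ^ j) (A x) := by
  rw [pow_succ]
  rfl

theorem bigShift_fst (x : BigSpace E F) :
    (bigShift E F x).fst = laurent (expSymbol F 1) x.fst := rfl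

theorem bigShift_snd (x : BigSpace E F) :
    (bigShift E F x).snd = laurent (expSymbol E 1) x.snd := rfl

theorem norm_bigShift (x : BigSpace E F) : ‖bigShift E F x‖ = ‖x‖ := by
  rw [← sq_eq_sq₀ (norm_nonneg _) (norm_nonneg _), WithLp.prod_norm_sq_eq_of_L2,
    WithLp.prod_norm_sq_eq_of_L2, bigShift_fst, bigShift_snd, norm_laurent_exp, norm_laurent_exp]

theorem norm_bigShift_pow (j : ℕ) (x : BigSpace E F) : ‖(bigShift E F ^ j) x‖ = ‖x‖ := by
  induction j with
  | zero => rfl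
  | succ j ih => rw [clm_pow_succ_apply, norm_bigShift, ih]

theorem coeffL_bigShift_pow_fst (j : ℕ) (n : ℤ) (x : BigSpace E F) :
    coeffL n ((bigShift E F ^ j) x).fst = coeffL (n - j) x.fst := by
  induction j generalizing n with
  | zero => simp
  | succ j ih =>
    rw [clm_pow_succ_apply, bigShift_fst, coeffL_laurent_exp, ih]
    congr 2
    push_cast
    ring

theorem coeffL_bigShift_pow_snd (j : ℕ) (n : ℤ) (x : BigSpace E F) :
    coeffL n ((bigShift E F ^ j) x).snd = coeffL (n - j) x.snd := by
  induction j generalizing n with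
  | zero => simp
  | succ j ih =>
    rw [clm_pow_succ_apply, bigShift_snd, coeffL_laurent_exp, ih]
    congr 2
    push_cast
    ring

theorem bigSpace_ext {x y : BigSpace E F} (h1 : ∀ n, coeffL n x.fst = coeffL n y.fst)
    (h2 : ∀ n, coeffL n x.snd = coeffL n y.snd) : x = y :=
  (WithLp.equiv 2 (L2 F × L2 E)).injective (Prod.ext (ext_coeffL h1) (ext_coeffL h2))

theorem inner_modelOp {Θ : C(Circ, E →L[ℂ] F)} (x y : modelSpace Θ) :
    ⟪x, modelOp Θ y⟫_ℂ = ⟪(x : BigSpace E F), bigShift E F y⟫_ℂ :=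
  Submodule.inner_orthogonalProjectionOnto_eq_of_mem_left x _

theorem coe_modelOp_of_mem {Θ : C(Circ, E →L[ℂ] F)} {x : modelSpace Θ}
    (hx : bigShift E F x ∈ modelSpace Θ) :
    (modelOp Θ x : BigSpace E F) = bigShift E F x :=
  congrArg Subtype.val
    (Submodule.orthogonalProjectionOnto_mem_subspace_eq_self (⟨_, hx⟩ : modelSpace Θ))

theorem coe_modelOp_pow_of_mem {Θ : C(Circ, E →L[ℂ] F)} {x : modelSpace Θ} {j : ℕ}
    (hx : ∀ i ≤ j, (bigShift E F ^ i) x ∈ modelSpace Θ) :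
    ((modelOp Θ ^ j) x : BigSpace E F) = (bigShift E F ^ j) x := by
  induction j with
  | zero => rfl
  | succ j ih =>
    have h1 := ih fun i hi => hx i (by omega)
    have h2 := hx (j + 1) le_rfl
    rw [clm_pow_succ_apply, ← h1] at h2
    rw [clm_pow_succ_apply, clm_pow_succ_apply, coe_modelOp_of_mem h2, h1]

/-- Multiplication by `e^{it}` is isometric, and a projection preserves the norm only of vectors in
its range. -/
theorem bigShift_mem_of_norm_modelOp {Θ : C(Circ, E →L[ℂ] F)} {x : modelSpace Θ}
    (hx : ‖modelOp Θ x‖ = ‖x‖) : bigShift E F x ∈ modelSpace Θ := by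
  rw [Submodule.mem_iff_norm_starProjection, norm_bigShift]
  exact hx

/-- On a unitary part the compression is genuine multiplication by `e^{it}`, so every vector can be
shifted arbitrarily far both ways inside the model space. Shifting back empties the first component,
and shifting forward the second. -/
theorem modelOp_isCompletelyNonUnitary_of_forall {Θ : C(Circ, E →L[ℂ] F)}
    (h1 : ∀ x ∈ modelSpace Θ, ∀ n : ℤ, n < 0 → coeffL n x.fst = 0)
    (h2 : ∀ x ∈ modelSpace Θ, ∀ n : ℤ, 0 ≤ n → coeffL n x.snd = 0) :
    IsCompletelyNonUnitary (modelOp Θ) := by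
  intro M hM hiso hsurj
  have hU : ∀ x ∈ M, (modelOp Θ x : BigSpace E F) = bigShift E F x := fun x hx =>
    coe_modelOp_of_mem (bigShift_mem_of_norm_modelOp (hiso x hx))
  have hfwd : ∀ j : ℕ, ∀ x ∈ M, ∃ y ∈ M, (y : BigSpace E F) = (bigShift E F ^ j) x := by
    intro j x hx
    induction j with
    | zero => exact ⟨x, hx, rfl⟩
    | succ j ih =>
      obtain ⟨y, hy, hyx⟩ := ih
      exact ⟨_, hM.2.1 y hy, by rw [hU y hy, hyx, clm_pow_succ_apply]⟩
  have hbwd : ∀ j : ℕ, ∀ x ∈ M, ∃ y ∈ M, (bigShift E F ^ j) (y : BigSpace E F) = x := by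
    intro j
    induction j with
    | zero => exact fun x hx => ⟨x, hx, rfl⟩
    | succ j ih =>
      intro x hx
      obtain ⟨y, hy, hyx⟩ := ih x hx
      obtain ⟨w, hw, hwy⟩ := hsurj y hy
      exact ⟨w, hw, by rw [clm_pow_succ_apply', ← hU w hw, hwy, hyx]⟩
  rw [eq_bot_iff]
  intro x hx
  rw [Submodule.mem_bot]
  apply Subtype.ext
  refine bigSpace_ext (fun n => ?_) fun n => ?_
  · obtain ⟨y, -, hyx⟩ := hbwd (n.toNat + 1) x hx
    rw [← hyx, coeffL_bigShift_pow_fst, h1 _ y.2 _ (by omega)]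
    exact (map_zero (coeffL (E := F) n)).symm
  · obtain ⟨y, -, hyx⟩ := hfwd (-n).toNat x hx
    have := h2 _ y.2 (n + (-n).toNat) (by omega)
    rw [hyx, coeffL_bigShift_pow_snd, add_sub_cancel_right] at this
    rw [this]
    exact (map_zero (coeffL (E := E) n)).symm

/-- `(ker A)ᗮ` is the closure of the range of `A^*`, and isometry passes to the closure. -/
theorem isPartialIsometry_of_norm_adjoint {X : Type*} [NormedAddCommGroup X]
    [InnerProductSpace ℂ X] [CompleteSpace X] {A : X →L[ℂ] X}
    (h : ∀ y, ‖A (adjoint A y)‖ = ‖adjoint A y‖) : IsPartialIsometry A := by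
  intro x hx
  have hx' : x ∈ (LinearMap.range (adjoint A : X →ₗ[ℂ] X)).topologicalClosure := by
    rw [← ContinuousLinearMap.orthogonal_ker]
    exact hx
  have hcl : IsClosed {x : X | ‖A x‖ = ‖x‖} :=
    isClosed_eq A.continuous.norm continuous_norm
  refine closure_minimal ?_ hcl hx'
  rintro _ ⟨y, rfl⟩
  exact h y

namespace OrthogonalPartialIsometries

variable {k : ℕ} {θ : ℕ → (E →L[ℂ] F)} (h : OrthogonalPartialIsometries k θ)
include h

theorem adjoint_modelOp_apply (x : modelSpace (polySymbol k θ)) :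
    ((ContinuousLinearMap.adjoint (modelOp (polySymbol k θ)) x :
        modelSpace (polySymbol k θ)) : BigSpace E F)
      = WithLp.toLp 2
        (laurent (expSymbol F (-1))
            ((x : BigSpace E F).fst
              - constL2 (fourierCoeff ((x : BigSpace E F).fst : Circ → F) 0)),
          laurent (expSymbol E (-1)) (x : BigSpace E F).snd) := by
  rw [← coeffL_apply]
  set z : BigSpace E F := WithLp.toLp 2
        (laurent (expSymbol F (-1))
            ((x : BigSpace E F).fst - constL2 (coeffL 0 (x : BigSpace E F).fst)),
          laurent (expSymbol E (-1)) (x : BigSpace E F).snd) with hz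
  obtain ⟨hx1, hx2, hx3, hx4⟩ := h.mem_modelSpace.1 x.2
  have hz1 : ∀ n : ℤ, coeffL n z.fst = if n = -1 then 0 else
      coeffL (n + 1) (x : BigSpace E F).fst := by
    intro n
    change coeffL n (laurent (expSymbol F (-1)) _) = _
    rw [coeffL_laurent_exp, map_sub, coeffL_constL2, sub_neg_eq_add]
    by_cases hn : n = -1
    · subst hn; simp
    · rw [if_neg hn, if_neg (by omega), sub_zero]
  have hz2 : ∀ n : ℤ, coeffL n z.snd = coeffL (n + 1) (x : BigSpace E F).snd := by
    intro n
    change coeffL n (laurent (expSymbol E (-1)) _) = _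
    rw [coeffL_laurent_exp, sub_neg_eq_add]
  -- The coefficient conditions survive a left shift, so no projection is needed in the formula for
  -- the adjoint.
  have hzmem : z ∈ modelSpace (polySymbol k θ) := by
    rw [h.mem_modelSpace]
    refine ⟨fun n hn => ?_, fun m hm n hn => ?_, fun n hn => ?_, fun m hm n => ?_⟩
    · rw [hz1]
      split_ifs with hn1
      · rfl
      · exact hx1 _ (by omega)
    · rw [hz1]
      split_ifs with hn1
      · rw [map_zero]
      · exact hx2 m hm _ (by omega)
    · rw [hz2, hx3 _ (by omega)]
    · rw [hz2, hx4 m hm]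
  have key : ContinuousLinearMap.adjoint (modelOp (polySymbol k θ)) x = ⟨z, hzmem⟩ := by
    refine ext_inner_right ℂ fun y => ?_
    obtain ⟨hy1, -⟩ := h.mem_modelSpace.1 y.2
    rw [adjoint_inner_left, inner_modelOp]
    change _ = ⟪z, (y : BigSpace E F)⟫_ℂ
    rw [WithLp.prod_inner_apply, WithLp.prod_inner_apply]
    change ⟪(x : BigSpace E F).fst, laurent (expSymbol F 1) (y : BigSpace E F).fst⟫_ℂ
        + ⟪(x : BigSpace E F).snd, laurent (expSymbol E 1) (y : BigSpace E F).snd⟫_ℂ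
      = ⟪laurent (expSymbol F (-1)) _, (y : BigSpace E F).fst⟫_ℂ
        + ⟪laurent (expSymbol E (-1)) _, (y : BigSpace E F).snd⟫_ℂ
    -- The subtracted constant pairs with the coefficient of `y.fst` at index `-1`, which is zero.
    rw [inner_laurent_exp, inner_laurent_exp, neg_neg, inner_sub_left, inner_constL2,
      coeffL_laurent_exp, hy1 _ (by omega), inner_zero_right, sub_zero]
  rw [key]

theorem coeffL_adjoint_modelOp_pow_fst (j : ℕ) (x : modelSpace (polySymbol k θ)) (n : ℤ) :
    coeffL n ((((ContinuousLinearMap.adjoint (modelOp (polySymbol k θ)) ^ j) x :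
      modelSpace (polySymbol k θ)) : BigSpace E F).fst)
      = if 0 ≤ n then coeffL (n + j) (x : BigSpace E F).fst else 0 := by
  induction j generalizing n with
  | zero =>
    split_ifs with hn
    · simp
    · exact (h.mem_modelSpace.1 x.2).1 n (by omega)
  | succ j ih =>
    rw [clm_pow_succ_apply, h.adjoint_modelOp_apply]
    change coeffL n (laurent (expSymbol F (-1)) (_ - constL2 (coeffL 0 _))) = _
    rw [coeffL_laurent_exp, map_sub, coeffL_constL2, ih, ih, sub_neg_eq_add]
    by_cases hn : n + 1 = 0
    · obtain rfl : n = -1 := by omega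
      simp
    · rw [if_neg hn, sub_zero]
      by_cases hn' : 0 ≤ n
      · rw [if_pos (by omega), if_pos hn']
        congr 2
        push_cast
        ring
      · rw [if_neg (by omega), if_neg hn']

theorem coeffL_adjoint_modelOp_pow_snd (j : ℕ) (x : modelSpace (polySymbol k θ)) (n : ℤ) :
    coeffL n ((((ContinuousLinearMap.adjoint (modelOp (polySymbol k θ)) ^ j) x :
      modelSpace (polySymbol k θ)) : BigSpace E F).snd)
      = coeffL (n + j) (x : BigSpace E F).snd := by
  induction j generalizing n with
  | zero => simp
  | succ j ih =>
    rw [clm_pow_succ_apply, h.adjoint_modelOp_apply]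
    change coeffL n (laurent (expSymbol E (-1)) _) = _
    rw [coeffL_laurent_exp, ih, sub_neg_eq_add]
    congr 2
    push_cast
    ring

theorem isPowerPartialIsometry_modelOp : IsPowerPartialIsometry (modelOp (polySymbol k θ)) := by
  intro n _
  refine isPartialIsometry_of_norm_adjoint fun y => ?_
  have hadj : ContinuousLinearMap.adjoint (modelOp (polySymbol k θ) ^ n)
      = ContinuousLinearMap.adjoint (modelOp (polySymbol k θ)) ^ n :=
    star_pow (modelOp (polySymbol k θ)) n
  rw [hadj]
  obtain ⟨hy1, hy2, hy3, hy4⟩ := h.mem_modelSpace.1 y.2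
  -- `n` left shifts leave room for `n` right shifts within the model space, so `T^n` is
  -- multiplication by `e^{int}` on the range of `T^{*n}`.
  have hmem : ∀ i ≤ n, (bigShift E F ^ i)
      (((ContinuousLinearMap.adjoint (modelOp (polySymbol k θ)) ^ n) y :
        modelSpace (polySymbol k θ)) : BigSpace E F) ∈ modelSpace (polySymbol k θ) := by
    intro i hi
    rw [h.mem_modelSpace]
    refine ⟨fun m hm => ?_, fun m hm l hl => ?_, fun m hm => ?_, fun m hm l => ?_⟩
    · rw [coeffL_bigShift_pow_fst, h.coeffL_adjoint_modelOp_pow_fst, if_neg (by omega)]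
    · rw [coeffL_bigShift_pow_fst, h.coeffL_adjoint_modelOp_pow_fst]
      split_ifs
      · exact hy2 m hm _ (by omega)
      · rw [map_zero]
    · rw [coeffL_bigShift_pow_snd, h.coeffL_adjoint_modelOp_pow_snd]
      exact hy3 _ (by omega)
    · rw [coeffL_bigShift_pow_snd, h.coeffL_adjoint_modelOp_pow_snd]
      exact hy4 m hm _
  rw [Submodule.coe_norm, coe_modelOp_pow_of_mem hmem, norm_bigShift_pow, Submodule.coe_norm]

theorem isCompletelyNonUnitary_modelOp : IsCompletelyNonUnitary (modelOp (polySymbol k θ)) :=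
  modelOp_isCompletelyNonUnitary_of_forall (fun _ hx => (h.mem_modelSpace.1 hx).1)
    (fun _ hx => (h.mem_modelSpace.1 hx).2.2.1)

/-- The model space as a sum of ranges. -/
theorem mem_modelSpace_iff_exists (x : BigSpace E F) :
    x ∈ modelSpace (polySymbol k θ) ↔
      ∃ f : H2 F, ∃ g ∈ (H2 E)ᗮ,
        x = WithLp.toLp 2
          (((f - toeplitz (polySymbol k θ)
              (ContinuousLinearMap.adjoint (toeplitz (polySymbol k θ)) f) : H2 F) : L2 F),
            laurent (defect (polySymbol k θ)) g) := by
  have hT : ∀ (f : H2 E) (n : ℤ), coeffL n (toeplitz (polySymbol k θ) f : L2 F)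
      = if 0 ≤ n then ∑ m ∈ Finset.Icc 1 k, θ m (coeffL (n - m) (f : L2 E)) else 0 := by
    intro f n
    change coeffL n ((H2 F).starProjection (laurent (polySymbol k θ) f)) = _
    rw [coeffL_starProjection_H2, coeffL_laurent_polySymbol]
  have hTadj : ∀ (f : H2 F) (n : ℤ),
      coeffL n (ContinuousLinearMap.adjoint (toeplitz (polySymbol k θ)) f : L2 E)
      = if 0 ≤ n then ∑ m ∈ Finset.Icc 1 k,
          ContinuousLinearMap.adjoint (θ m) (coeffL (n + m) (f : L2 F)) else 0 := by
    intro f n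
    rw [← coeffL_adjoint_laurent_polySymbol, ← coeffL_starProjection_H2]
    congr 1
    rw [toeplitz, adjoint_comp, adjoint_comp, Submodule.adjoint_subtypeL,
      Submodule.adjoint_orthogonalProjectionOnto]
    rfl
  rw [h.defect_polySymbol]
  constructor
  · intro hx
    obtain ⟨hx1, hx2, hx3, hx4⟩ := h.mem_modelSpace.1 hx
    -- The components of `x` are their own witnesses: `T_Θ^*` kills the first and the defect
    -- projection fixes the second.
    refine ⟨⟨x.fst, mem_H2.2 hx1⟩, x.snd, mem_H2_orthogonal.2 hx3, ?_⟩
    have h0 : ContinuousLinearMap.adjoint (toeplitz (polySymbol k θ))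
        (⟨x.fst, mem_H2.2 hx1⟩ : H2 F) = 0 := by
      apply Subtype.ext
      refine ext_coeffL fun n => ?_
      rw [hTadj, Submodule.coe_zero, map_zero]
      split_ifs
      · exact Finset.sum_eq_zero fun m hm => hx2 m hm _ (by omega)
      · rfl
    rw [h0, map_zero, sub_zero]
    refine bigSpace_ext (fun n => rfl) fun n => ?_
    change _ = coeffL n (laurent _ x.snd)
    rw [coeffL_laurent_const, defectProj_eq_self_of_forall fun m hm => hx4 m hm n]
  · rintro ⟨f, g, hg, rfl⟩
    rw [h.mem_modelSpace]
    refine ⟨?_, fun m hm n hn => ?_, fun n hn => ?_, fun m hm n => ?_⟩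
    · exact mem_H2.1 (Subtype.prop (f - toeplitz (polySymbol k θ)
        (ContinuousLinearMap.adjoint (toeplitz (polySymbol k θ)) f)))
    · change ContinuousLinearMap.adjoint (θ m) (coeffL n ((f : L2 F)
        - (toeplitz (polySymbol k θ)
          (ContinuousLinearMap.adjoint (toeplitz (polySymbol k θ)) f) : H2 F))) = 0
      -- As `n - m ≥ 0`, the projection to `H²` inside `T_Θ^*` discards nothing here, and
      -- `θ_m^*(T_ΘT_Θ^*f)_n` collapses to `θ_m^*f_n`.
      rw [map_sub, hT, if_pos (by omega), map_sub, map_sum, Finset.sum_eq_single m]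
      · rw [hTadj, if_pos (by omega), map_sum, map_sum, Finset.sum_eq_single m]
        · rw [adjoint_apply_adjoint (h.apply_adjoint_apply m hm), sub_add_cancel, sub_self]
        · intro j hj hjm
          rw [h.apply_adjoint_of_ne m hm j hj hjm.symm, map_zero]
        · exact fun h => absurd hm h
      · intro j hj hjm
        exact h.adjoint_apply_of_ne m hm j hj hjm.symm _
      · exact fun h => absurd hm h
    · change coeffL n (laurent _ g) = 0
      rw [coeffL_laurent_const, mem_H2_orthogonal.1 hg n hn, map_zero]
    · change θ m (coeffL n (laurent _ g)) = 0
      rw [coeffL_laurent_const, h.apply_defectProj hm]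

end OrthogonalPartialIsometries

end ModelOperator

/-! ### Criteria for reducing subspaces, shifts and nilpotents. -/

section HilbertSpace

variable {X : Type*} [NormedAddCommGroup X] [InnerProductSpace ℂ X]

theorem coe_restrict_pow {T : X →L[ℂ] X} {M : Submodule ℂ X} (hM : ∀ x ∈ M, T x ∈ M) (n : ℕ)
    (x : M) : ((T.restrict hM ^ n) x : X) = (T ^ n) x := by
  induction n with
  | zero => rfl
  | succ n ih => rw [clm_pow_succ_apply, clm_pow_succ_apply, coe_restrict_apply, ih]

theorem pow_mem_of_mapsTo {T : X →L[ℂ] X} {M : Submodule ℂ X} (hM : ∀ x ∈ M, T x ∈ M) (n : ℕ)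
    {x : X} (hx : x ∈ M) : (T ^ n) x ∈ M := by
  rw [← coe_restrict_pow hM n ⟨x, hx⟩]
  exact Subtype.prop _

theorem eq_orthogonal_of_isOrtho_of_sup_eq_top {M N : Submodule ℂ X} (h : M ⟂ N)
    (hMN : M ⊔ N = ⊤) : M = Nᗮ := by
  refine le_antisymm h fun x hx => ?_
  obtain ⟨a, ha, b, hb, rfl⟩ := Submodule.mem_sup.1 (hMN.ge (Submodule.mem_top (x := x)))
  have h1 : ⟪b, a + b⟫_ℂ = 0 := hx b hb
  have h2 : ⟪b, a⟫_ℂ = 0 := h ha b hb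
  rw [inner_add_right, h2, zero_add, inner_self_eq_zero] at h1
  rwa [h1, add_zero]

variable [CompleteSpace X]

/-- Invariance of `N = Mᗮ` under `T^*` is invariance of `M` under `T`, so only the explicit `T^*`
has to be examined. -/
theorem isReducing_of_adjoint_mem {T : X →L[ℂ] X} {M N : Submodule ℂ X} (h : M ⟂ N)
    (hMN : M ⊔ N = ⊤) (hM : ∀ x ∈ M, adjoint T x ∈ M) (hN : ∀ x ∈ N, adjoint T x ∈ N) :
    IsReducing T M := by
  have hMe := eq_orthogonal_of_isOrtho_of_sup_eq_top h hMN
  refine ⟨hMe ▸ Submodule.isClosed_orthogonal N, fun x hx => ?_, hM⟩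
  rw [hMe]
  intro y hy
  rw [← adjoint_inner_left]
  exact h hx _ (hN y hy)

/-- An isometry whose wandering subspace generates the whole space is a unilateral shift. -/
theorem isUnilateralShift_of_forall {S : X →L[ℂ] X} (hS : ∀ x, ‖S x‖ = ‖x‖)
    (h : ∀ x, (∀ n : ℕ, ∀ w, (∀ y, ⟪S y, w⟫_ℂ = 0) → ⟪(S ^ n) w, x⟫_ℂ = 0) → x = 0) :
    IsUnilateralShift S := by
  have hi : ∀ x y, ⟪S x, S y⟫_ℂ = ⟪x, y⟫_ℂ := fun x y =>
    LinearIsometry.inner_map_map (⟨(S : X →ₗ[ℂ] X), hS⟩ : X →ₗᵢ[ℂ] X) x y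
  have hin : ∀ (n : ℕ) (x y : X), ⟪(S ^ n) x, (S ^ n) y⟫_ℂ = ⟪x, y⟫_ℂ := by
    intro n
    induction n with
    | zero => exact fun _ _ => rfl
    | succ n ih => exact fun x y => by rw [clm_pow_succ_apply, clm_pow_succ_apply, hi, ih]
  set W : Submodule ℂ X := (LinearMap.range (S : X →ₗ[ℂ] X))ᗮ with hW
  have hWmem : ∀ w, w ∈ W ↔ ∀ y, ⟪S y, w⟫_ℂ = 0 := fun w =>
    ⟨fun hw y => hw _ ⟨y, rfl⟩, by rintro hw _ ⟨y, rfl⟩; exact hw y⟩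
  have hlt : ∀ m d : ℕ, ∀ v ∈ W, ∀ w ∈ W, ⟪(S ^ (m + (d + 1))) v, (S ^ m) w⟫_ℂ = 0 := by
    intro m d v _ w hw
    rw [pow_add]
    change ⟪(S ^ m) ((S ^ (d + 1)) v), (S ^ m) w⟫_ℂ = 0
    rw [hin, clm_pow_succ_apply]
    exact (hWmem w).1 hw _
  refine ⟨hS, W, Submodule.isClosed_orthogonal _, fun m n hmn => ?_, ?_⟩
  · rw [Submodule.isOrtho_iff_inner_eq]
    rintro _ ⟨v, hv, rfl⟩ _ ⟨w, hw, rfl⟩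
    rcases lt_or_gt_of_ne hmn with hlt' | hlt'
    · obtain ⟨d, rfl⟩ := Nat.exists_eq_add_of_lt hlt'
      exact inner_eq_zero_symm.1 (hlt m d w hw v hv)
    · obtain ⟨d, rfl⟩ := Nat.exists_eq_add_of_lt hlt'
      exact hlt n d v hv w hw
  · rw [Submodule.topologicalClosure_eq_top_iff, Submodule.eq_bot_iff]
    intro x hx
    refine h x fun n w hw => ?_
    exact hx _ (Submodule.mem_iSup_of_mem n ⟨w, (hWmem w).2 hw, rfl⟩)

theorem isUnilateralShift_restrict_of_forall {T : X →L[ℂ] X} {M : Submodule ℂ X}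
    (hM : ∀ x ∈ M, T x ∈ M) (hcl : IsClosed (M : Set X)) (hT : ∀ x ∈ M, ‖T x‖ = ‖x‖)
    (h : ∀ x ∈ M, (∀ n : ℕ, ∀ w ∈ M, (∀ y ∈ M, ⟪w, T y⟫_ℂ = 0) → ⟪(T ^ n) w, x⟫_ℂ = 0) → x = 0) :
    IsUnilateralShift (T.restrict hM) := by
  have hcomplete : CompleteSpace M := hcl.completeSpace_coe
  refine isUnilateralShift_of_forall (fun x => hT x x.2) fun x hx => Subtype.ext ?_
  refine h x x.2 fun n w hw hwT => ?_
  have h1 := hx n ⟨w, hw⟩ fun y => inner_eq_zero_symm.1 (hwT y y.2)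
  rwa [Submodule.coe_inner, coe_restrict_pow] at h1

/-- `‖T^k x‖² = ⟪x, T^{*k} T^k x⟫` vanishes, as `T^k x` stays in `M`. Vanishing is thus tested on
`T^*`, non-vanishing on `T`. -/
theorem isNilpotentOfIndex_restrict {T : X →L[ℂ] X} {M : Submodule ℂ X}
    (hM : ∀ x ∈ M, T x ∈ M) {k : ℕ} (hk : ∀ x ∈ M, (adjoint T ^ k) x = 0)
    (hj : ∀ j < k, ∃ x ∈ M, (T ^ j) x ≠ 0) : IsNilpotentOfIndex (T.restrict hM) k := by
  refine ⟨?_, fun j hjk h0 => ?_⟩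
  · ext x
    rw [coe_restrict_pow]
    have hadj : adjoint (T ^ k) = adjoint T ^ k := star_pow T k
    have : ⟪(T ^ k) x, (T ^ k) x⟫_ℂ = 0 := by
      rw [← adjoint_inner_right, hadj, hk _ (pow_mem_of_mapsTo hM k x.2), inner_zero_right]
    exact inner_self_eq_zero.1 this
  · obtain ⟨x, hx, hne⟩ := hj j hjk
    refine hne ?_
    rw [← coe_restrict_pow hM j ⟨x, hx⟩, h0]
    rfl

end HilbertSpace

/-! ### The three reducing summands. -/

section Decomposition

variable {E : Type*} [NormedAddCommGroup E] [InnerProductSpace ℂ E] [CompleteSpace E]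
variable {F : Type*} [NormedAddCommGroup F] [InnerProductSpace ℂ F] [CompleteSpace F]

theorem inner_laurent_defectProj (k : ℕ) (θ : ℕ → (E →L[ℂ] F)) (f g : L2 E) :
    ⟪laurent (constSymbol (defectProj k θ)) f, g⟫_ℂ
      = ⟪f, laurent (constSymbol (defectProj k θ)) g⟫_ℂ := by
  rw [inner_laurent_const, adjoint_defectProj]

namespace OrthogonalPartialIsometries

variable {k : ℕ} {θ : ℕ → (E →L[ℂ] F)} (h : OrthogonalPartialIsometries k θ)
include h

theorem mem_shiftPart {x : BigSpace E F} :
    x ∈ shiftPart k θ ↔ (∀ n : ℤ, n < 0 → coeffL n x.fst = 0) ∧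
      (∀ m ∈ Finset.Icc 1 k, ∀ n : ℤ, ContinuousLinearMap.adjoint (θ m) (coeffL n x.fst) = 0) ∧
      x.snd = 0 := by
  have hmem : x ∈ shiftPart k θ ↔ x.fst ∈ (H2 F).map (laurent (constSymbol
      (ContinuousLinearMap.id ℂ F - ∑ m ∈ Finset.Icc 1 k,
        θ m ∘L ContinuousLinearMap.adjoint (θ m))) : L2 F →ₗ[ℂ] L2 F) ∧ x.snd = 0 := Iff.rfl
  rw [hmem, ← defectProj_adjoint, ← and_assoc]
  refine and_congr_left fun _ => ?_
  constructor
  · rintro ⟨f, hf, hfx⟩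
    have hc : ∀ n, coeffL n x.fst
        = defectProj k (fun m => ContinuousLinearMap.adjoint (θ m)) (coeffL n f) := fun n => by
      rw [← hfx, ContinuousLinearMap.coe_coe, coeffL_laurent_const]
    refine ⟨fun n hn => ?_, fun m hm n => ?_⟩
    · rw [hc, mem_H2.1 hf n hn, map_zero]
    · rw [hc]
      exact h.adjoint.apply_defectProj hm _
  · rintro ⟨h1, h2⟩
    refine ⟨x.fst, mem_H2.2 h1, ext_coeffL fun n => ?_⟩
    rw [ContinuousLinearMap.coe_coe, coeffL_laurent_const]
    exact defectProj_eq_self_of_forall fun m hm => h2 m hm n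

theorem mem_backwardPart {x : BigSpace E F} :
    x ∈ backwardPart k θ ↔ x.fst = 0 ∧ (∀ n : ℤ, 0 ≤ n → coeffL n x.snd = 0) ∧
      (∀ m ∈ Finset.Icc 1 k, ∀ n : ℤ, θ m (coeffL n x.snd) = 0) := by
  have hmem : x ∈ backwardPart k θ ↔ x.fst = 0 ∧
    x.snd ∈ (H2 E)ᗮ.map (laurent (constSymbol (defectProj k θ)) : L2 E →ₗ[ℂ] L2 E) := Iff.rfl
  rw [hmem]
  refine and_congr_right fun _ => ?_
  constructor
  · rintro ⟨f, hf, hfx⟩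
    have hc : ∀ n, coeffL n x.snd = defectProj k θ (coeffL n f) := fun n => by
      rw [← hfx, ContinuousLinearMap.coe_coe, coeffL_laurent_const]
    refine ⟨fun n hn => ?_, fun m hm n => ?_⟩
    · rw [hc, mem_H2_orthogonal.1 hf n hn, map_zero]
    · rw [hc, h.apply_defectProj hm]
  · rintro ⟨h1, h2⟩
    refine ⟨x.snd, mem_H2_orthogonal.2 h1, ext_coeffL fun n => ?_⟩
    rw [ContinuousLinearMap.coe_coe, coeffL_laurent_const]
    exact defectProj_eq_self_of_forall fun m hm => h2 m hm n

theorem shiftPart_le_modelSpace : shiftPart k θ ≤ modelSpace (polySymbol k θ) := by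
  intro x hx
  obtain ⟨h1, h2, h3⟩ := h.mem_shiftPart.1 hx
  rw [h.mem_modelSpace, h3]
  exact ⟨h1, fun m hm n _ => h2 m hm n, fun n _ => map_zero _,
    fun m hm n => by rw [map_zero, map_zero]⟩

theorem toLp_defectProj_mem_shiftPart {x : BigSpace E F}
    (hx : x ∈ modelSpace (polySymbol k θ)) :
    (WithLp.toLp 2 (laurent (constSymbol
      (defectProj k (fun m => ContinuousLinearMap.adjoint (θ m)))) x.fst, 0) : BigSpace E F)
      ∈ shiftPart k θ := by
  rw [h.mem_shiftPart]
  refine ⟨fun n hn => ?_, fun m hm n => ?_, rfl⟩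
  · change coeffL n (laurent _ _) = 0
    rw [coeffL_laurent_const, (h.mem_modelSpace.1 hx).1 n hn, map_zero]
  · change ContinuousLinearMap.adjoint (θ m) (coeffL n (laurent _ _)) = 0
    rw [coeffL_laurent_const]
    exact h.adjoint.apply_defectProj hm _

theorem backwardPart_le_modelSpace : backwardPart k θ ≤ modelSpace (polySymbol k θ) := by
  intro x hx
  obtain ⟨h1, h2, h3⟩ := h.mem_backwardPart.1 hx
  rw [h.mem_modelSpace, h1]
  exact ⟨fun n _ => map_zero _, fun m hm n _ => by rw [map_zero, map_zero], h2, h3⟩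

end OrthogonalPartialIsometries

/-- The part of the model space on which the model operator is a shift. -/
noncomputable def shiftSummand (k : ℕ) (θ : ℕ → (E →L[ℂ] F)) :
    Submodule ℂ (modelSpace (polySymbol k θ)) :=
  (shiftPart k θ).comap (modelSpace (polySymbol k θ)).subtype

/-- The part of the model space on which the model operator is a backward shift. -/
noncomputable def backwardSummand (k : ℕ) (θ : ℕ → (E →L[ℂ] F)) :
    Submodule ℂ (modelSpace (polySymbol k θ)) :=
  (backwardPart k θ).comap (modelSpace (polySymbol k θ)).subtype

/-- The part of the model space on which the model operator is nilpotent. -/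
noncomputable def nilpotentSummand (k : ℕ) (θ : ℕ → (E →L[ℂ] F)) :
    Submodule ℂ (modelSpace (polySymbol k θ)) :=
  (shiftSummand k θ ⊔ backwardSummand k θ)ᗮ

theorem inner_modelSpace {Θ : C(Circ, E →L[ℂ] F)} (x y : modelSpace Θ) :
    ⟪x, y⟫_ℂ = ⟪(x : BigSpace E F).fst, (y : BigSpace E F).fst⟫_ℂ
      + ⟪(x : BigSpace E F).snd, (y : BigSpace E F).snd⟫_ℂ := rfl

namespace OrthogonalPartialIsometries

variable {k : ℕ} {θ : ℕ → (E →L[ℂ] F)} (h : OrthogonalPartialIsometries k θ)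
include h

theorem mem_shiftSummand {x : modelSpace (polySymbol k θ)} :
    x ∈ shiftSummand k θ ↔
      (∀ m ∈ Finset.Icc 1 k, ∀ n : ℤ,
        ContinuousLinearMap.adjoint (θ m) (coeffL n (x : BigSpace E F).fst) = 0) ∧
      (x : BigSpace E F).snd = 0 :=
  h.mem_shiftPart.trans (and_iff_right (h.mem_modelSpace.1 x.2).1)

theorem mem_backwardSummand {x : modelSpace (polySymbol k θ)} :
    x ∈ backwardSummand k θ ↔ (x : BigSpace E F).fst = 0 :=
  h.mem_backwardPart.trans (and_iff_left (h.mem_modelSpace.1 x.2).2.2)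

/-- With `D = I - ∑ θ_mθ_m^*` acting on coefficients, `x = u ⊕ v` is tested against its own parts
`Du ⊕ 0` and `0 ⊕ v`; the converse uses that `D` is symmetric and fixes the shift part. -/
theorem mem_nilpotentSummand {x : modelSpace (polySymbol k θ)} :
    x ∈ nilpotentSummand k θ ↔
      (∀ n : ℤ, defectProj k (fun m => ContinuousLinearMap.adjoint (θ m))
        (coeffL n (x : BigSpace E F).fst) = 0) ∧ (x : BigSpace E F).snd = 0 := by
  set D := laurent (constSymbol (defectProj k (fun m => ContinuousLinearMap.adjoint (θ m))))
    with hD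
  obtain ⟨hx1, hx2, hx3, hx4⟩ := h.mem_modelSpace.1 x.2
  constructor
  · intro hx
    have hsmem := h.toLp_defectProj_mem_shiftPart x.2
    rw [← hD] at hsmem
    have hbmem : (WithLp.toLp 2 (0, (x : BigSpace E F).snd) : BigSpace E F)
        ∈ backwardPart k θ := h.mem_backwardPart.2 ⟨rfl, hx3, hx4⟩
    have h1 := hx ⟨_, h.shiftPart_le_modelSpace hsmem⟩ (Submodule.mem_sup_left hsmem)
    have h2 := hx ⟨_, h.backwardPart_le_modelSpace hbmem⟩ (Submodule.mem_sup_right hbmem)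
    rw [inner_modelSpace] at h1 h2
    change ⟪D (x : BigSpace E F).fst, (x : BigSpace E F).fst⟫_ℂ
      + ⟪(0 : L2 E), (x : BigSpace E F).snd⟫_ℂ = 0 at h1
    change ⟪(0 : L2 F), (x : BigSpace E F).fst⟫_ℂ
      + ⟪(x : BigSpace E F).snd, (x : BigSpace E F).snd⟫_ℂ = 0 at h2
    have hDD : D (D (x : BigSpace E F).fst) = D (x : BigSpace E F).fst := by
      refine ext_coeffL fun n => ?_
      rw [hD, coeffL_laurent_const, coeffL_laurent_const, h.adjoint.defectProj_defectProj]
    rw [inner_zero_left, add_zero, ← hDD, hD, inner_laurent_defectProj, ← hD,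
      inner_self_eq_zero] at h1
    rw [inner_zero_left, zero_add, inner_self_eq_zero] at h2
    refine ⟨fun n => ?_, h2⟩
    rw [← coeffL_laurent_const, ← hD, h1, map_zero]
  · rintro ⟨h1, h2⟩
    have hD0 : D (x : BigSpace E F).fst = 0 := coeffL_injective fun n => by
      rw [hD, coeffL_laurent_const, h1]
    rw [nilpotentSummand, ← Submodule.inf_orthogonal]
    constructor
    · intro s hs
      obtain ⟨hs1, hs2⟩ := h.mem_shiftSummand.1 hs
      have hDs : D (s : BigSpace E F).fst = (s : BigSpace E F).fst := ext_coeffL fun n => by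
        rw [hD, coeffL_laurent_const]
        exact defectProj_eq_self_of_forall fun m hm => hs1 m hm n
      rw [inner_modelSpace, h2, inner_zero_right, add_zero, ← hDs, hD, inner_laurent_defectProj,
        ← hD, hD0, inner_zero_right]
    · intro b hb
      rw [inner_modelSpace, h2, h.mem_backwardSummand.1 hb, inner_zero_left, inner_zero_right,
        add_zero]

theorem shiftSummand_isOrtho_backwardSummand : shiftSummand k θ ⟂ backwardSummand k θ := by
  rw [Submodule.isOrtho_iff_inner_eq]
  intro s hs b hb
  rw [inner_modelSpace, (h.mem_shiftSummand.1 hs).2, h.mem_backwardSummand.1 hb,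
    inner_zero_left, inner_zero_right, add_zero]

omit h in
theorem shiftSummand_isOrtho_nilpotentSummand : shiftSummand k θ ⟂ nilpotentSummand k θ :=
  (Submodule.isOrtho_orthogonal_right _).mono_left le_sup_left

omit h in
theorem nilpotentSummand_isOrtho_backwardSummand : nilpotentSummand k θ ⟂ backwardSummand k θ :=
  ((Submodule.isOrtho_orthogonal_right _).mono_left le_sup_right).symm

theorem summands_sup_eq_top :
    shiftSummand k θ ⊔ nilpotentSummand k θ ⊔ backwardSummand k θ = ⊤ := by
  rw [eq_top_iff]
  intro x _
  set D := laurent (constSymbol (defectProj k (fun m => ContinuousLinearMap.adjoint (θ m))))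
    with hD
  obtain ⟨hx1, hx2, hx3, hx4⟩ := h.mem_modelSpace.1 x.2
  have hsmem := h.toLp_defectProj_mem_shiftPart x.2
  rw [← hD] at hsmem
  have hbmem : (WithLp.toLp 2 (0, (x : BigSpace E F).snd) : BigSpace E F)
      ∈ backwardPart k θ := h.mem_backwardPart.2 ⟨rfl, hx3, hx4⟩
  set s : modelSpace (polySymbol k θ) := ⟨_, h.shiftPart_le_modelSpace hsmem⟩ with hs
  set b : modelSpace (polySymbol k θ) := ⟨_, h.backwardPart_le_modelSpace hbmem⟩ with hb
  -- The remainder is `(I - D)u ⊕ 0`, which the projection `D` annihilates.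
  have ht : x - s - b ∈ nilpotentSummand k θ := by
    rw [h.mem_nilpotentSummand]
    constructor
    · intro n
      change defectProj k _ (coeffL n ((x : BigSpace E F).fst - D (x : BigSpace E F).fst - 0)) = 0
      rw [sub_zero, map_sub, hD, coeffL_laurent_const, map_sub, h.adjoint.defectProj_defectProj,
        sub_self]
    · change (x : BigSpace E F).snd - 0 - (x : BigSpace E F).snd = 0
      rw [sub_zero, sub_self]
  have hsum : x = s + (x - s - b) + b := by abel
  rw [hsum]
  exact Submodule.add_mem_sup (Submodule.add_mem_sup hsmem ht) hbmem

theorem coeffL_adjoint_modelOp_fst (x : modelSpace (polySymbol k θ)) (n : ℤ) :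
    coeffL n ((ContinuousLinearMap.adjoint (modelOp (polySymbol k θ)) x :
      modelSpace (polySymbol k θ)) : BigSpace E F).fst
      = if 0 ≤ n then coeffL (n + 1) (x : BigSpace E F).fst else 0 := by
  simpa using h.coeffL_adjoint_modelOp_pow_fst 1 x n

theorem adjoint_modelOp_snd (x : modelSpace (polySymbol k θ)) :
    ((ContinuousLinearMap.adjoint (modelOp (polySymbol k θ)) x :
      modelSpace (polySymbol k θ)) : BigSpace E F).snd
      = laurent (expSymbol E (-1)) (x : BigSpace E F).snd :=
  congrArg WithLp.snd (h.adjoint_modelOp_apply x)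

theorem adjoint_modelOp_mem_shiftSummand {x : modelSpace (polySymbol k θ)}
    (hx : x ∈ shiftSummand k θ) :
    ContinuousLinearMap.adjoint (modelOp (polySymbol k θ)) x ∈ shiftSummand k θ := by
  obtain ⟨h1, h2⟩ := h.mem_shiftSummand.1 hx
  rw [h.mem_shiftSummand, h.adjoint_modelOp_snd, h2, map_zero]
  refine ⟨fun m hm n => ?_, rfl⟩
  rw [h.coeffL_adjoint_modelOp_fst]
  split_ifs
  · exact h1 m hm _
  · exact map_zero _

theorem adjoint_modelOp_mem_nilpotentSummand {x : modelSpace (polySymbol k θ)}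
    (hx : x ∈ nilpotentSummand k θ) :
    ContinuousLinearMap.adjoint (modelOp (polySymbol k θ)) x ∈ nilpotentSummand k θ := by
  obtain ⟨h1, h2⟩ := h.mem_nilpotentSummand.1 hx
  rw [h.mem_nilpotentSummand, h.adjoint_modelOp_snd, h2, map_zero]
  refine ⟨fun n => ?_, rfl⟩
  rw [h.coeffL_adjoint_modelOp_fst]
  split_ifs
  · exact h1 _
  · exact map_zero _

theorem adjoint_modelOp_mem_backwardSummand {x : modelSpace (polySymbol k θ)}
    (hx : x ∈ backwardSummand k θ) :
    ContinuousLinearMap.adjoint (modelOp (polySymbol k θ)) x ∈ backwardSummand k θ := by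
  rw [h.mem_backwardSummand] at hx ⊢
  refine coeffL_injective fun n => ?_
  rw [h.coeffL_adjoint_modelOp_fst, hx, map_zero, ite_self]

omit h in
theorem mem_sup_of_mapsTo {X : Type*} [NormedAddCommGroup X] [InnerProductSpace ℂ X]
    {A : X →L[ℂ] X} {M N : Submodule ℂ X} (hM : ∀ x ∈ M, A x ∈ M) (hN : ∀ x ∈ N, A x ∈ N) :
    ∀ x ∈ M ⊔ N, A x ∈ M ⊔ N := by
  intro x hx
  obtain ⟨a, ha, b, hb, rfl⟩ := Submodule.mem_sup.1 hx
  rw [map_add]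
  exact Submodule.add_mem_sup (hM a ha) (hN b hb)

theorem isReducing_shiftSummand : IsReducing (modelOp (polySymbol k θ)) (shiftSummand k θ) :=
  isReducing_of_adjoint_mem
    (N := nilpotentSummand k θ ⊔ backwardSummand k θ)
    (Submodule.isOrtho_sup_right.2
      ⟨shiftSummand_isOrtho_nilpotentSummand, h.shiftSummand_isOrtho_backwardSummand⟩)
    (by rw [← sup_assoc, h.summands_sup_eq_top])
    (fun _ => h.adjoint_modelOp_mem_shiftSummand)
    (mem_sup_of_mapsTo (fun _ => h.adjoint_modelOp_mem_nilpotentSummand)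
      (fun _ => h.adjoint_modelOp_mem_backwardSummand))

theorem isReducing_nilpotentSummand :
    IsReducing (modelOp (polySymbol k θ)) (nilpotentSummand k θ) :=
  isReducing_of_adjoint_mem
    (N := shiftSummand k θ ⊔ backwardSummand k θ)
    (Submodule.isOrtho_orthogonal_left _)
    (by rw [← sup_assoc, sup_comm (nilpotentSummand k θ), h.summands_sup_eq_top])
    (fun _ => h.adjoint_modelOp_mem_nilpotentSummand)
    (mem_sup_of_mapsTo (fun _ => h.adjoint_modelOp_mem_shiftSummand)
      (fun _ => h.adjoint_modelOp_mem_backwardSummand))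

theorem isReducing_backwardSummand :
    IsReducing (modelOp (polySymbol k θ)) (backwardSummand k θ) :=
  isReducing_of_adjoint_mem
    (N := shiftSummand k θ ⊔ nilpotentSummand k θ)
    (Submodule.isOrtho_sup_right.2 ⟨h.shiftSummand_isOrtho_backwardSummand.symm,
      nilpotentSummand_isOrtho_backwardSummand.symm⟩)
    (by rw [sup_comm, h.summands_sup_eq_top])
    (fun _ => h.adjoint_modelOp_mem_backwardSummand)
    (mem_sup_of_mapsTo (fun _ => h.adjoint_modelOp_mem_shiftSummand)
      (fun _ => h.adjoint_modelOp_mem_nilpotentSummand))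

end OrthogonalPartialIsometries

end Decomposition

/-! ### Shift, backward shift and nilpotent part. -/

section Summands

variable {E : Type*} [NormedAddCommGroup E] [InnerProductSpace ℂ E] [CompleteSpace E]
variable {F : Type*} [NormedAddCommGroup F] [InnerProductSpace ℂ F] [CompleteSpace F]

theorem bigShift_pow_constL2 (n : ℕ) (a : F) :
    (bigShift E F ^ n) (WithLp.toLp 2 (constL2 a, 0))
      = WithLp.toLp 2 (laurent (expSymbol F n) (constL2 a), 0) := by
  refine bigSpace_ext (fun i => ?_) fun i => ?_
  · rw [coeffL_bigShift_pow_fst]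
    change coeffL (i - n) (constL2 a) = coeffL i (laurent _ (constL2 a))
    rw [coeffL_laurent_exp]
  · rw [coeffL_bigShift_pow_snd]
    exact (map_zero (coeffL (E := E) _)).trans (map_zero (coeffL (E := E) _)).symm

namespace OrthogonalPartialIsometries

variable {k : ℕ} {θ : ℕ → (E →L[ℂ] F)} (h : OrthogonalPartialIsometries k θ)
include h

theorem toLp_monomial_mem_modelSpace {n : ℕ} {a : F}
    (ha : ∀ m ∈ Finset.Icc 1 k, m ≤ n → ContinuousLinearMap.adjoint (θ m) a = 0) :
    (WithLp.toLp 2 (laurent (expSymbol F n) (constL2 a), 0) : BigSpace E F)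
      ∈ modelSpace (polySymbol k θ) := by
  have hc : ∀ i : ℤ, coeffL i
      (WithLp.toLp 2 (laurent (expSymbol F n) (constL2 a), 0) : BigSpace E F).fst
      = if i = n then a else 0 := fun i => coeffL_monomial n i a
  rw [h.mem_modelSpace]
  refine ⟨fun i hi => ?_, fun m hm i hi => ?_, fun i _ => map_zero _,
    fun m _ i => (congrArg (θ m) (map_zero _)).trans (map_zero _)⟩
  · rw [hc, if_neg (by omega)]
  · rw [hc]
    split_ifs with hin
    · exact ha m hm (by omega)
    · rw [map_zero]

theorem toLp_constL2_mem_modelSpace (a : F) :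
    (WithLp.toLp 2 (constL2 a, 0) : BigSpace E F) ∈ modelSpace (polySymbol k θ) := by
  have := h.toLp_monomial_mem_modelSpace (n := 0) (a := a) fun m hm h0 => by
    rw [Finset.mem_Icc] at hm
    omega
  rwa [Nat.cast_zero, laurent_exp_zero] at this

/-- The model operator moves the monomial `a` to `z ^ n a` inside the model space. -/
theorem coe_modelOp_pow_constL2 {n : ℕ} {a : F}
    (ha : ∀ m ∈ Finset.Icc 1 k, m ≤ n → ContinuousLinearMap.adjoint (θ m) a = 0) :
    ((modelOp (polySymbol k θ) ^ n) ⟨_, h.toLp_constL2_mem_modelSpace a⟩ : BigSpace E F)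
      = WithLp.toLp 2 (laurent (expSymbol F n) (constL2 a), 0) := by
  rw [coe_modelOp_pow_of_mem, bigShift_pow_constL2]
  intro i hi
  rw [bigShift_pow_constL2]
  exact h.toLp_monomial_mem_modelSpace fun m hm hmi => ha m hm (hmi.trans hi)

/-- Here `θ_m^*` kills the coefficients at all indices, so a right shift meets no obstruction. -/
theorem bigShift_mem_of_mem_shiftSummand {x : modelSpace (polySymbol k θ)}
    (hx : x ∈ shiftSummand k θ) : bigShift E F x ∈ modelSpace (polySymbol k θ) := by
  obtain ⟨h1, h2⟩ := h.mem_shiftSummand.1 hx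
  rw [h.mem_modelSpace, bigShift_fst, bigShift_snd, h2, map_zero]
  refine ⟨fun n hn => ?_, fun m hm n _ => ?_, fun n _ => map_zero _,
    fun m _ n => (congrArg (θ m) (map_zero _)).trans (map_zero _)⟩
  · rw [coeffL_laurent_exp, (h.mem_modelSpace.1 x.2).1 _ (by omega)]
  · rw [coeffL_laurent_exp, h1 m hm]

theorem modelOp_mem_shiftSummand : ∀ x ∈ shiftSummand k θ,
    modelOp (polySymbol k θ) x ∈ shiftSummand k θ := h.isReducing_shiftSummand.2.1

theorem modelOp_mem_nilpotentSummand : ∀ x ∈ nilpotentSummand k θ,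
    modelOp (polySymbol k θ) x ∈ nilpotentSummand k θ := h.isReducing_nilpotentSummand.2.1

theorem modelOp_mem_backwardSummand : ∀ x ∈ backwardSummand k θ,
    modelOp (polySymbol k θ) x ∈ backwardSummand k θ := h.isReducing_backwardSummand.2.1

theorem isUnilateralShift_shiftSummand :
    IsUnilateralShift (X := shiftSummand k θ)
      ((modelOp (polySymbol k θ)).restrict h.modelOp_mem_shiftSummand) := by
  refine isUnilateralShift_restrict_of_forall _ h.isReducing_shiftSummand.1
    (fun x hx => ?_) fun x hxmem hx => ?_
  · rw [Submodule.coe_norm, coe_modelOp_of_mem (h.bigShift_mem_of_mem_shiftSummand hx),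
      norm_bigShift, Submodule.coe_norm]
  obtain ⟨hx1, hx2⟩ := h.mem_shiftSummand.1 hxmem
  apply Subtype.ext
  refine bigSpace_ext (fun n => ?_) fun n => ?_
  · change _ = coeffL n (0 : L2 F)
    rw [map_zero]
    rcases lt_or_ge n 0 with hn | hn
    · exact (h.mem_modelSpace.1 x.2).1 n hn
    obtain ⟨n, rfl⟩ := Int.eq_ofNat_of_zero_le hn
    set a := coeffL (n : ℤ) (x : BigSpace E F).fst with ha
    have ha0 : ∀ m ∈ Finset.Icc 1 k, ContinuousLinearMap.adjoint (θ m) a = 0 :=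
      fun m hm => hx1 m hm n
    -- The constant `a` is a wandering vector, and `T^n` carries it to `z^n a`, whose inner product
    -- with `x` is `‖a‖²`.
    have hort := hx n ⟨_, h.toLp_constL2_mem_modelSpace a⟩
      (h.mem_shiftSummand.2 ⟨fun m hm i => ?_, rfl⟩) fun y hy => ?_
    · rw [inner_modelSpace, h.coe_modelOp_pow_constL2 fun m hm _ => ha0 m hm, hx2,
        inner_zero_right, add_zero] at hort
      change ⟪laurent (expSymbol F n) (constL2 a), (x : BigSpace E F).fst⟫_ℂ = 0 at hort
      rwa [inner_laurent_exp_constL2, ← ha, inner_self_eq_zero] at hort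
    · change ContinuousLinearMap.adjoint (θ m) (coeffL i (constL2 a)) = 0
      rw [coeffL_constL2]
      split_ifs
      · exact ha0 m hm
      · exact map_zero _
    · rw [inner_modelSpace, coe_modelOp_of_mem (h.bigShift_mem_of_mem_shiftSummand hy),
        bigShift_fst]
      change ⟪constL2 a, _⟫_ℂ + ⟪(0 : L2 E), _⟫_ℂ = 0
      rw [inner_zero_left, add_zero, inner_constL2, coeffL_laurent_exp,
        (h.mem_modelSpace.1 y.2).1 _ (by omega), inner_zero_right]
  · rw [hx2]
    rfl

theorem norm_of_mem_backwardSummand {x : modelSpace (polySymbol k θ)}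
    (hx : x ∈ backwardSummand k θ) : ‖x‖ = ‖(x : BigSpace E F).snd‖ := by
  rw [Submodule.coe_norm, ← sq_eq_sq₀ (norm_nonneg _) (norm_nonneg _),
    WithLp.prod_norm_sq_eq_of_L2, h.mem_backwardSummand.1 hx]
  simp

theorem toLp_monomial_mem_backwardPart {a : E} (ha : ∀ m ∈ Finset.Icc 1 k, θ m a = 0) :
    (WithLp.toLp 2 (0, laurent (expSymbol E (-1)) (constL2 a)) : BigSpace E F)
      ∈ backwardPart k θ := by
  refine h.mem_backwardPart.2 ⟨rfl, fun i hi => ?_, fun m hm i => ?_⟩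
  · change coeffL i (laurent (expSymbol E (-1)) (constL2 a)) = 0
    rw [coeffL_monomial, if_neg (by omega)]
  · change θ m (coeffL i (laurent (expSymbol E (-1)) (constL2 a))) = 0
    rw [coeffL_monomial]
    split_ifs
    · exact ha m hm
    · exact map_zero _

theorem adjoint_modelOp_pow_snd (j : ℕ) (x : modelSpace (polySymbol k θ)) :
    ((((ContinuousLinearMap.adjoint (modelOp (polySymbol k θ))) ^ j) x :
      modelSpace (polySymbol k θ)) : BigSpace E F).snd
      = laurent (expSymbol E (-j)) (x : BigSpace E F).snd :=
  ext_coeffL fun i => by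
    rw [h.coeffL_adjoint_modelOp_pow_snd, coeffL_laurent_exp, sub_neg_eq_add]

theorem isUnilateralShift_backwardSummand :
    IsUnilateralShift (X := backwardSummand k θ)
      ((ContinuousLinearMap.adjoint (modelOp (polySymbol k θ))).restrict
        fun _ => h.adjoint_modelOp_mem_backwardSummand) := by
  refine isUnilateralShift_restrict_of_forall _ h.isReducing_backwardSummand.1
    (fun x hx => ?_) fun x hxmem hx => ?_
  · rw [h.norm_of_mem_backwardSummand hx,
      h.norm_of_mem_backwardSummand (h.adjoint_modelOp_mem_backwardSummand hx),
      h.adjoint_modelOp_snd, norm_laurent_exp]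
  have hfst := h.mem_backwardSummand.1 hxmem
  obtain ⟨-, -, hx3, hx4⟩ := h.mem_modelSpace.1 x.2
  apply Subtype.ext
  refine bigSpace_ext (fun n => ?_) fun n => ?_
  · rw [hfst]
    rfl
  · change _ = coeffL n (0 : L2 E)
    rw [map_zero]
    rcases le_or_gt 0 n with hn | hn
    · exact hx3 n hn
    -- Wandering vectors for `T^*` sit at index `-1`, hence `j` applications reach index `-j-1`.
    obtain ⟨j, rfl⟩ : ∃ j : ℕ, n = -j + -1 := ⟨(-1 - n).toNat, by omega⟩
    set a := coeffL (-j + -1 : ℤ) (x : BigSpace E F).snd with ha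
    have hwmem := h.toLp_monomial_mem_backwardPart (a := a) fun m hm => hx4 m hm _
    have hort := hx j ⟨_, h.backwardPart_le_modelSpace hwmem⟩ hwmem fun y hy => ?_
    · rw [inner_modelSpace, hfst, inner_zero_right, zero_add,
        h.adjoint_modelOp_pow_snd] at hort
      change ⟪laurent (expSymbol E (-j)) (laurent (expSymbol E (-1)) (constL2 a)),
        (x : BigSpace E F).snd⟫_ℂ = 0 at hort
      rwa [laurent_exp_exp, inner_laurent_exp_constL2, ← ha, inner_self_eq_zero] at hort
    · rw [inner_modelSpace, h.adjoint_modelOp_snd]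
      change ⟪(0 : L2 F), _⟫_ℂ + ⟪laurent (expSymbol E (-1)) (constL2 a), _⟫_ℂ = 0
      rw [inner_zero_left, zero_add, inner_laurent_exp_constL2, coeffL_laurent_exp,
        (h.mem_modelSpace.1 y.2).2.2.1 _ (by omega), inner_zero_right]

theorem isBackwardShift_backwardSummand :
    IsBackwardShift (X := backwardSummand k θ)
      ((modelOp (polySymbol k θ)).restrict h.modelOp_mem_backwardSummand) :=
  ⟨_, h.isUnilateralShift_backwardSummand, fun x y =>
    (adjoint_inner_right (modelOp (polySymbol k θ)) (x : modelSpace (polySymbol k θ))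
      (y : modelSpace (polySymbol k θ))).symm⟩

theorem isNilpotentOfIndex_nilpotentSummand (hk : 1 ≤ k) (hdeg : θ k ≠ 0) :
    IsNilpotentOfIndex (X := nilpotentSummand k θ)
      ((modelOp (polySymbol k θ)).restrict h.modelOp_mem_nilpotentSummand) k := by
  have hkk : k ∈ Finset.Icc 1 k := Finset.mem_Icc.2 ⟨hk, le_rfl⟩
  refine isNilpotentOfIndex_restrict _ (fun x hx => ?_) fun j hj => ?_
  · obtain ⟨h1, h2⟩ := h.mem_nilpotentSummand.1 hx
    apply Subtype.ext
    refine bigSpace_ext (fun n => ?_) fun n => ?_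
    · rw [h.coeffL_adjoint_modelOp_pow_fst]
      change _ = coeffL n (0 : L2 F)
      rw [map_zero]
      split_ifs with hn
      -- At index `n + k ≥ m` every `θ_m^*` kills the coefficient, so `I - ∑ θ_mθ_m^*` fixes it,
      -- whereas on this summand that projection gives zero.
      · rw [← h1 (n + k)]
        refine (defectProj_eq_self_of_forall fun m hm => ?_).symm
        rw [Finset.mem_Icc] at hm
        exact (h.mem_modelSpace.1 x.2).2.1 m (Finset.mem_Icc.2 hm) _ (by omega)
      · rfl
    · rw [h.coeffL_adjoint_modelOp_pow_snd, h2]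
      exact (map_zero (coeffL (E := E) _)).trans (map_zero (coeffL (E := E) _)).symm
  · obtain ⟨a, ha⟩ : ∃ a, θ k a ≠ 0 := by
      by_contra! hall
      exact hdeg (ContinuousLinearMap.ext hall)
    -- A constant from the final space of `θ_k` starts a block of full length: `θ_m^*θ_k = 0` for `m
    -- ≤ j < k` keeps `z^j θ_k a` in the model space.
    refine ⟨⟨_, h.toLp_constL2_mem_modelSpace (θ k a)⟩, ?_, fun h0 => ha ?_⟩
    · refine h.mem_nilpotentSummand.2 ⟨fun n => ?_, rfl⟩
      change defectProj k _ (coeffL n (constL2 (θ k a))) = 0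
      rw [coeffL_constL2]
      split_ifs
      · have := h.adjoint.defectProj_adjoint_apply hkk a
        rwa [adjoint_adjoint] at this
      · exact map_zero _
    · have h1 := h.coe_modelOp_pow_constL2 (n := j) (a := θ k a) fun m hm hmj =>
        h.adjoint_apply_of_ne m hm k hkk (by omega) a
      rw [h0] at h1
      have h2 := congrArg (fun z : BigSpace E F => coeffL (j : ℤ) z.fst) h1
      change coeffL (j : ℤ) (0 : L2 F)
        = coeffL (j : ℤ) (laurent (expSymbol F j) (constL2 (θ k a))) at h2
      rw [map_zero, coeffL_monomial, if_pos rfl] at h2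
      exact h2.symm

end OrthogonalPartialIsometries

end Summands

theorem mainTheorem4
    {E : Type*} [NormedAddCommGroup E] [InnerProductSpace ℂ E] [CompleteSpace E]
    {F : Type*} [NormedAddCommGroup F] [InnerProductSpace ℂ F] [CompleteSpace F]
    (k : ℕ) (hk : 1 ≤ k) (θ : ℕ → (E →L[ℂ] F)) (hdeg : θ k ≠ 0)
    (hpi : ∀ m ∈ Finset.Icc 1 k, IsPartialIsometry (θ m))
    (hcontr : IsContractiveAnalytic (opPoly k θ)) :
    -- the description of the model space and of the model operator
    (∀ x : BigSpace E F, x ∈ modelSpace (polySymbol k θ) ↔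
      ∃ f : H2 F, ∃ g ∈ (H2 E)ᗮ,
        x = WithLp.toLp 2
          (((f - toeplitz (polySymbol k θ) (adjoint (toeplitz (polySymbol k θ)) f) : H2 F) : L2 F),
            laurent (defect (polySymbol k θ)) g)) ∧
    (∀ x : modelSpace (polySymbol k θ),
      ((adjoint (modelOp (polySymbol k θ)) x : modelSpace (polySymbol k θ)) : BigSpace E F)
        = WithLp.toLp 2
          (laurent (expSymbol F (-1))
              ((x : BigSpace E F).fst
                - constL2 (fourierCoeff ((x : BigSpace E F).fst : Circ → F) 0)),
            laurent (expSymbol E (-1)) (x : BigSpace E F).snd)) ∧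
    IsPowerPartialIsometry (modelOp (polySymbol k θ)) ∧
    IsCompletelyNonUnitary (modelOp (polySymbol k θ)) ∧
    -- the decomposition
    ∃ Hs Ht Hb : Submodule ℂ (modelSpace (polySymbol k θ)),
      Hs.map (modelSpace (polySymbol k θ)).subtype = shiftPart k θ ∧
      Hb.map (modelSpace (polySymbol k θ)).subtype = backwardPart k θ ∧
      Ht = (Hs ⊔ Hb)ᗮ ∧
      IsReducing (modelOp (polySymbol k θ)) Hs ∧
      IsReducing (modelOp (polySymbol k θ)) Ht ∧
      IsReducing (modelOp (polySymbol k θ)) Hb ∧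
      Hs ⟂ Ht ∧ Hs ⟂ Hb ∧ Ht ⟂ Hb ∧ Hs ⊔ Ht ⊔ Hb = ⊤ ∧
      ∃ (S : Hs →L[ℂ] Hs) (N : Ht →L[ℂ] Ht) (C : Hb →L[ℂ] Hb),
        (∀ (s : Hs) (t : Ht) (b : Hb),
          modelOp (polySymbol k θ) ((s : modelSpace (polySymbol k θ)) + t + b)
            = (S s : modelSpace (polySymbol k θ)) + N t + C b) ∧
        IsUnilateralShift (X := Hs) S ∧
        IsNilpotentOfIndex (X := Ht) N k ∧
        IsBackwardShift (X := Hb) C := by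
  have h := orthogonalPartialIsometries_of_contractive hpi hcontr
  refine ⟨h.mem_modelSpace_iff_exists, h.adjoint_modelOp_apply, h.isPowerPartialIsometry_modelOp,
    h.isCompletelyNonUnitary_modelOp, shiftSummand k θ, nilpotentSummand k θ,
    backwardSummand k θ, ?_, ?_, rfl, h.isReducing_shiftSummand, h.isReducing_nilpotentSummand,
    h.isReducing_backwardSummand, OrthogonalPartialIsometries.shiftSummand_isOrtho_nilpotentSummand,
    h.shiftSummand_isOrtho_backwardSummand,
    OrthogonalPartialIsometries.nilpotentSummand_isOrtho_backwardSummand,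
    h.summands_sup_eq_top, _, _, _, fun s t b => ?_, h.isUnilateralShift_shiftSummand,
    h.isNilpotentOfIndex_nilpotentSummand hk hdeg, h.isBackwardShift_backwardSummand⟩
  · exact (Submodule.map_comap_subtype _ _).trans (inf_eq_right.2 h.shiftPart_le_modelSpace)
  · exact (Submodule.map_comap_subtype _ _).trans (inf_eq_right.2 h.backwardPart_le_modelSpace)
  · rw [map_add, map_add]
    rfl
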